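/- For real $\alpha>-1$, real $\beta$ and a natural number $n\ge 1$ let \[ P_n^{(\alpha,\beta)}(x)=\frac{(\alpha+1)_n}{n!}\sum_{k=0}^{\infty}\frac{(-n)_k\,(n+\alpha+\beta+1)_k}{k!\,(\alpha+1)_k}\Big(\frac{1-x}{2}\Big)^k \] be the Jacobi polynomial, where $(a)_k=a(a+1)\cdots(a+k-1)$, and put \[ \phi_n^{(\alpha,\beta)}(\mu)=\sum_{k=0}^{\lfloor n/2\rfloor}\frac{d^{2k}}{dx^{2k}}P_n^{(\alpha,\beta)}(x)\Big|_{x=1}\,\mu^k . \] Two real polynomials $g$ and $h$ are said to be interlacing if all zeros of $g$ and of $h$ are real and simple, $g$ and $h$ are coprime, between each two consecutive zeros of $g$ there is exactly one zero of $h$, and between each two consecutive zeros of $h$ there is exactly one zero of $g$. Let $n\ge 3$, and let $\alpha,\beta$ be real numbers such that either $-1<\alpha<1$ and $\beta>-1$, or $1\le\alpha<2$ and $\beta>0$. Then the derivatives with respect to $\mu$ \[ \big(\phi_n^{(\alpha,\beta)}\big)',\qquad \big(\phi_{n-1}^{(\alpha,\beta)}\big)',\qquad \big(\phi_n^{(\alpha,\beta-1)}\big)'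 \] are pairwise interlacing. -/

import Mathlib

open Polynomial

noncomputable section

/-- The Jacobi polynomial `P_n^{(α,β)}`, from its terminating hypergeometric series
`(α+1)_n / n! * ∑_k (-n)_k (n+α+β+1)_k / (k! (α+1)_k) * ((1-x)/2)^k`
(the terms with `k > n` vanish); `(ascPochhammer ℝ k).eval a` is the rising factorial `(a)_k`. -/
def jacobiP (n : ℕ) (α β : ℝ) : ℝ[X] :=
  C ((ascPochhammer ℝ n).eval (α + 1) / (n.factorial : ℝ)) *
    ∑ k ∈ Finset.range (n + 1),
      C ((ascPochhammer ℝ k).eval (-(n : ℝ)) * (ascPochhammer ℝ k).eval ((n : ℝ) + α + β + 1) /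
          ((k.factorial : ℝ) * (ascPochhammer ℝ k).eval (α + 1))) *
        (C (1 / 2 : ℝ) * (1 - X)) ^ k

/-- `φ_n^{(α,β)}(μ) = ∑_{k=0}^{[n/2]} (P_n^{(α,β)})^{(2k)}(1) * μ^k`. -/
def jacobiPhi (n : ℕ) (α β : ℝ) : ℝ[X] :=
  ∑ k ∈ Finset.range (n / 2 + 1),
    C ((derivative^[2 * k] (jacobiP n α β)).eval 1) * X ^ k

/-- All complex zeros of the real polynomial `g` are real and simple.
(The zero polynomial does not satisfy this.) -/
def HasSimpleRealZeros (g : ℝ[X]) : Prop :=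
  ∀ z : ℂ, (g.map (algebraMap ℝ ℂ)).eval z = 0 →
    z.im = 0 ∧ (g.map (algebraMap ℝ ℂ)).rootMultiplicity z = 1

/-- Between each two consecutive real zeros of `g` there is exactly one zero of `h`. -/
def ExactlyOneZeroBetween (g h : ℝ[X]) : Prop :=
  ∀ a b : ℝ, a < b → g.eval a = 0 → g.eval b = 0 →
    (∀ c ∈ Set.Ioo a b, g.eval c ≠ 0) → ∃! c : ℝ, c ∈ Set.Ioo a b ∧ h.eval c = 0

/-- The zeros of `g` and `h` interlace (strictly). -/
structure ZerosInterlace (g h : ℝ[X]) : Prop where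
  simple_left : HasSimpleRealZeros g
  simple_right : HasSimpleRealZeros h
  coprime : IsCoprime g h
  left_right : ExactlyOneZeroBetween g h
  right_left : ExactlyOneZeroBetween h g

end

/-! Let S_n be the derivative of Φ_n(z) = ∑ P_n^{(k)}(1) z^k (`jacobiHurwitz`). Since φ_n(z²) is the
even part of Φ_n, the odd part of S_n is 2zφ_n'(z²), so stability of S_n controls the zeros of φ_n'
as in the Hermite–Biehler theorem.

The analytic core is `IsBetaFunctional.re_div_pos_of_zero`. A zero of S_n + ρS_{n-1} makes an
equation f - ζf' = R solvable with f divisible by X². Pairing that equation with a conjugate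
polynomial in the Jacobi inner product, and using orthogonality and integration by parts, gives
Re(S_n / (z S_{n-1})) > 0 on the closed right half-plane away from 0. Both parameter ranges lie in
-1 < α < 2, β > -1, where this works.

Two consequences follow. S_n + ρS_{n-1} is Hurwitz for ρ ≥ 0, so φ_n' + ρφ_{n-1}' has only real
zeros. At each zero of φ_{n-1}' the signs of φ_n' and φ_{n-1}'' are opposite, so by partial
fractions the Wronskian of φ_n' and φ_{n-1}' is positive on ℝ when n ≥ 4. Finally φ_n^{(α,β-1)} is a
positive combination of φ_n and φ_{n-1}, so all three Wronskians are nonzero multiples of one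
another, and Rolle's theorem gives interlacing. -/

/-! ### Interlacing and the sign of the Wronskian -/

theorem Polynomial.exists_isRoot_between_of_wronskian_ne_zero {g h : ℝ[X]}
    (hW : ∀ x, (derivative g).eval x * h.eval x - g.eval x * (derivative h).eval x ≠ 0)
    {a b : ℝ} (hab : a < b) (ha : g.eval a = 0) (hb : g.eval b = 0) :
    ∃ c ∈ Set.Ioo a b, h.eval c = 0 := by
  by_contra! hne
  have hne' : ∀ c ∈ Set.Icc a b, h.eval c ≠ 0 := by
    intro c hc h0
    rcases eq_or_lt_of_le hc.1 with rfl | h1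
    · exact hW a (by rw [ha, h0]; ring)
    rcases eq_or_lt_of_le hc.2 with rfl | h2
    · exact hW c (by rw [hb, h0]; ring)
    exact hne c ⟨h1, h2⟩ h0
  -- Rolle's theorem for g/h, whose derivative is the Wronskian over h².
  obtain ⟨c, hc, h0⟩ := exists_hasDerivAt_eq_zero (f := fun x => g.eval x / h.eval x)
    (f' := fun x => ((derivative g).eval x * h.eval x - g.eval x * (derivative h).eval x) /
      h.eval x ^ 2) hab
    (g.continuous.continuousOn.div h.continuous.continuousOn hne') (by simp [ha, hb])
    (fun x hx => (g.hasDerivAt x).div (h.hasDerivAt x) (hne' x ⟨hx.1.le, hx.2.le⟩))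
  have := hne' c ⟨hc.1.le, hc.2.le⟩
  rcases div_eq_zero_iff.1 h0 with h1 | h1
  · exact hW c h1
  · exact this (by simpa using h1)

theorem wronskian_swap_ne_zero {g h : ℝ[X]}
    (hW : ∀ x, (derivative g).eval x * h.eval x - g.eval x * (derivative h).eval x ≠ 0) (x : ℝ) :
    (derivative h).eval x * g.eval x - h.eval x * (derivative g).eval x ≠ 0 := by
  intro h0
  exact hW x (by linear_combination -h0)

/-- Uniqueness uses the symmetry of the hypothesis: two zeros of `h` in the gap would enclose a
further zero of `g`. -/
theorem exactlyOneZeroBetween_of_wronskian_ne_zero {g h : ℝ[X]}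
    (hW : ∀ x, (derivative g).eval x * h.eval x - g.eval x * (derivative h).eval x ≠ 0) :
    ExactlyOneZeroBetween g h := by
  intro a b hab ha hb hc
  obtain ⟨c, hcI, hc0⟩ := exists_isRoot_between_of_wronskian_ne_zero hW hab ha hb
  refine ⟨c, ⟨hcI, hc0⟩, ?_⟩
  rintro d ⟨hdI, hd0⟩
  rcases lt_trichotomy c d with hcd | hcd | hcd
  · obtain ⟨e, he, he0⟩ := exists_isRoot_between_of_wronskian_ne_zero
      (wronskian_swap_ne_zero hW) hcd hc0 hd0
    exact absurd he0 (hc e ⟨hcI.1.trans he.1, he.2.trans hdI.2⟩)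
  · exact hcd.symm
  · obtain ⟨e, he, he0⟩ := exists_isRoot_between_of_wronskian_ne_zero
      (wronskian_swap_ne_zero hW) hcd hd0 hc0
    exact absurd he0 (hc e ⟨hdI.1.trans he.1, he.2.trans hcI.2⟩)

theorem Polynomial.eval_map_algebraMap_ofReal (g : ℝ[X]) (x : ℝ) :
    (g.map (algebraMap ℝ ℂ)).eval (x : ℂ) = ((g.eval x : ℝ) : ℂ) := by
  rw [eval_map_algebraMap]
  exact Polynomial.aeval_algebraMap_apply_eq_algebraMap_eval x g

theorem hasSimpleRealZeros_of_derivative_ne_zero {g : ℝ[X]} (hg0 : g ≠ 0)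
    (hg : ∀ z : ℂ, (g.map (algebraMap ℝ ℂ)).eval z = 0 → z.im = 0)
    (hd : ∀ x : ℝ, g.eval x = 0 → (derivative g).eval x ≠ 0) : HasSimpleRealZeros g := by
  intro z hz
  refine ⟨hg z hz, ?_⟩
  have hzx : z = ((z.re : ℝ) : ℂ) := Complex.ext rfl (by simpa using hg z hz)
  have hne : g.map (algebraMap ℝ ℂ) ≠ 0 :=
    (Polynomial.map_ne_zero_iff (algebraMap ℝ ℂ).injective).2 hg0
  have hpos : 0 < (g.map (algebraMap ℝ ℂ)).rootMultiplicity z :=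
    (rootMultiplicity_pos hne).2 hz
  have hle : ¬ 1 < (g.map (algebraMap ℝ ℂ)).rootMultiplicity z := by
    rw [one_lt_rootMultiplicity_iff_isRoot hne]
    rintro ⟨-, h2⟩
    rw [IsRoot, derivative_map, hzx, eval_map_algebraMap_ofReal] at h2
    rw [hzx, eval_map_algebraMap_ofReal] at hz
    exact hd z.re (by exact_mod_cast hz) (by exact_mod_cast h2)
  omega

theorem zerosInterlace_of_wronskian_ne_zero {g h : ℝ[X]}
    (hg : ∀ z : ℂ, (g.map (algebraMap ℝ ℂ)).eval z = 0 → z.im = 0)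
    (hh : ∀ z : ℂ, (h.map (algebraMap ℝ ℂ)).eval z = 0 → z.im = 0)
    (hW : ∀ x, (derivative g).eval x * h.eval x - g.eval x * (derivative h).eval x ≠ 0) :
    ZerosInterlace g h where
  simple_left := hasSimpleRealZeros_of_derivative_ne_zero
    (by rintro rfl; exact hW 0 (by simp)) hg
    (fun x h1 h2 => hW x (by rw [h1, h2]; ring))
  simple_right := hasSimpleRealZeros_of_derivative_ne_zero
    (by rintro rfl; exact hW 0 (by simp)) hh
    (fun x h1 h2 => hW x (by rw [h1, h2]; ring))
  coprime := by
    rw [isCoprime_iff_aeval_ne_zero_of_isAlgClosed ℝ ℂ]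
    intro z
    by_contra! hz
    obtain ⟨h1, h2⟩ := hz
    rw [← eval_map_algebraMap] at h1 h2
    have hzx : z = ((z.re : ℝ) : ℂ) := Complex.ext rfl (by simpa using hg z h1)
    rw [hzx, eval_map_algebraMap_ofReal] at h1 h2
    refine hW z.re ?_
    rw [show g.eval z.re = 0 by exact_mod_cast h1, show h.eval z.re = 0 by exact_mod_cast h2]
    ring
  left_right := exactlyOneZeroBetween_of_wronskian_ne_zero hW
  right_left := exactlyOneZeroBetween_of_wronskian_ne_zero (wronskian_swap_ne_zero hW)

/-- The degenerate case n = 3, where the derivatives are constants and every Wronskian vanishes. -/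
theorem zerosInterlace_C {a b : ℝ} (ha : a ≠ 0) (hb : b ≠ 0) : ZerosInterlace (C a) (C b) where
  simple_left := fun z hz => absurd hz (by simpa using ha)
  simple_right := fun z hz => absurd hz (by simpa using hb)
  coprime := ⟨C a⁻¹, 0, by rw [← C_mul, inv_mul_cancel₀ ha, C_1, zero_mul, add_zero]⟩
  left_right := fun x y _ hx => absurd hx (by simpa using ha)
  right_left := fun x y _ hx => absurd hx (by simpa using hb)

/-- A real polynomial whose complex zeros are real and simple has as many real roots as its degree. -/
theorem card_roots_toFinset_of_real_zeros {h : ℝ[X]} (h0 : h ≠ 0)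
    (hh : ∀ z : ℂ, (h.map (algebraMap ℝ ℂ)).eval z = 0 → z.im = 0)
    (hd : ∀ x : ℝ, h.eval x = 0 → (derivative h).eval x ≠ 0) :
    h.roots.toFinset.card = h.natDegree := by
  have hs : h.Splits := by
    refine Splits.of_splits_map (algebraMap ℝ ℂ) (IsAlgClosed.splits _) ?_
    intro z hz
    have hz' := (mem_roots'.1 hz).2
    exact ⟨z.re, Complex.ext rfl (by simpa using (hh z hz').symm)⟩
  rw [Multiset.toFinset_card_of_nodup, hs.natDegree_eq_card_roots]
  rw [Multiset.nodup_iff_count_le_one]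
  intro x
  rw [count_roots]
  by_contra! hlt
  rw [one_lt_rootMultiplicity_iff_isRoot h0] at hlt
  exact hd x hlt.1 hlt.2

/-- Partial fractions: g/h = c₁x + c₀ + ∑ (g(r)/h'(r))/(x - r) with c₁ ≥ 0 and all residues
negative, so g/h increases between its poles. Multiplying its derivative by h² gives c₁h² plus
positive multiples of the squares (h/(x - r))². If `h` is constant the sum is empty, hence `hpos`.
-/
theorem Polynomial.wronskian_pos_of_root_sign {g h : ℝ[X]} (h0 : h ≠ 0)
    (hh : ∀ z : ℂ, (h.map (algebraMap ℝ ℂ)).eval z = 0 → z.im = 0)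
    (hgh : ∀ x : ℝ, h.eval x = 0 → g.eval x * (derivative h).eval x < 0)
    (hdeg : g.natDegree ≤ h.natDegree + 1)
    (hlc : 0 ≤ g.coeff (h.natDegree + 1) * h.leadingCoeff)
    (hpos : h.natDegree = 0 → 0 < g.coeff (h.natDegree + 1) * h.leadingCoeff) (x : ℝ) :
    0 < (derivative g).eval x * h.eval x - g.eval x * (derivative h).eval x := by
  have hd : ∀ x : ℝ, h.eval x = 0 → (derivative h).eval x ≠ 0 :=
    fun x hx h1 => absurd (hgh x hx) (by simp [h1])
  have hcard := card_roots_toFinset_of_real_zeros h0 hh hd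
  set s := h.roots.toFinset with hs
  have hmem : ∀ r, r ∈ s ↔ h.eval r = 0 := fun r => by simp [hs, h0]
  set d := h.natDegree with hdd
  have hl : h.leadingCoeff ≠ 0 := leadingCoeff_ne_zero.2 h0
  set c1 := g.coeff (d + 1) / h.leadingCoeff with hc1
  set g' := g - C c1 * X * h with hg'
  set c0 := g'.coeff d / h.leadingCoeff with hc0
  set g'' := g' - C c0 * h with hg''
  have hg'd : g'.natDegree ≤ d := by
    rw [natDegree_le_iff_coeff_eq_zero]
    intro N hN
    rcases Nat.exists_eq_add_of_lt hN with ⟨k, rfl⟩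
    rw [hg', mul_assoc, coeff_sub, coeff_C_mul, show d + k + 1 = (d + k) + 1 by ring, coeff_X_mul]
    rcases Nat.eq_zero_or_pos k with rfl | hk
    · rw [hc1, add_zero, show h.coeff d = h.leadingCoeff from rfl]; field_simp; ring
    · rw [coeff_eq_zero_of_natDegree_lt (p := g) (by omega),
        coeff_eq_zero_of_natDegree_lt (p := h) (by omega)]; ring
  have hg''d : g''.degree < d := by
    rw [degree_lt_iff_coeff_zero]
    intro N hN
    rw [hg'', coeff_sub, coeff_C_mul]
    rcases Nat.eq_or_lt_of_le hN with rfl | hk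
    · rw [hc0, show h.coeff d = h.leadingCoeff from rfl]; field_simp; ring
    · rw [coeff_eq_zero_of_natDegree_lt (p := g') (by omega),
        coeff_eq_zero_of_natDegree_lt (p := h) (by omega)]; ring
  set q : ℝ → ℝ[X] := fun r => h /ₘ (X - C r) with hq
  have hqr : ∀ r ∈ s, (X - C r) * q r = h := fun r hr =>
    mul_divByMonic_eq_iff_isRoot.2 ((hmem r).1 hr)
  have hqe : ∀ r ∈ s, ∀ y, (y - r) * (q r).eval y = h.eval y := fun r hr y => by
    conv_rhs => rw [← hqr r hr]
    simp
  have hqd : ∀ r ∈ s, ∀ y, (derivative h).eval y = (q r).eval y + (y - r) * (derivative (q r)).eval y :=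
    fun r hr y => by
      conv_lhs => rw [← hqr r hr]
      simp
  have hqself : ∀ r ∈ s, (q r).eval r = (derivative h).eval r := fun r hr => by
    rw [hqd r hr r]; ring
  have hg'e : ∀ r ∈ s, g''.eval r = g.eval r := fun r hr => by
    simp [hg'', hg', (hmem r).1 hr]
  have hinterp : g'' = ∑ r ∈ s, C (g.eval r / (derivative h).eval r) * q r := by
    refine eq_of_degrees_lt_of_eval_finset_eq s (by rwa [hcard]) ?_ ?_
    · rw [hcard]
      rw [degree_lt_iff_coeff_zero]
      intro N hN
      rw [finsetSum_coeff]
      refine Finset.sum_eq_zero fun r _ => ?_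
      rw [coeff_C_mul, coeff_eq_zero_of_degree_lt, mul_zero]
      refine (degree_divByMonic_lt h (X - C r) h0 (by simp)).trans_le ?_
      rw [degree_eq_natDegree h0]
      exact_mod_cast hN
    · intro r hr
      rw [eval_finsetSum, Finset.sum_eq_single r]
      · rw [hg'e r hr, eval_mul, eval_C, hqself r hr, div_mul_cancel₀ _ (hd r ((hmem r).1 hr))]
      · intro r' hr' hne
        have := hqe r' hr' r
        rw [(hmem r).1 hr] at this
        rcases mul_eq_zero.1 this with h1 | h1
        · exact absurd (sub_eq_zero.1 h1).symm hne
        · simp [h1]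
      · exact fun h => absurd hr h
  have hgx : g = C c1 * X * h + C c0 * h + g'' := by rw [hg'', hg']; ring
  have key : (derivative g).eval x * h.eval x - g.eval x * (derivative h).eval x =
      c1 * h.eval x ^ 2 +
        ∑ r ∈ s, -(g.eval r / (derivative h).eval r) * (q r).eval x ^ 2 := by
    have e1 : (derivative g'').eval x * h.eval x - g''.eval x * (derivative h).eval x =
        ∑ r ∈ s, -(g.eval r / (derivative h).eval r) * (q r).eval x ^ 2 := by
      rw [hinterp, derivative_sum, eval_finsetSum, eval_finsetSum, Finset.sum_mul, Finset.sum_mul,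
        ← Finset.sum_sub_distrib]
      refine Finset.sum_congr rfl fun r hr => ?_
      rw [derivative_C_mul, eval_mul, eval_mul, eval_C, hqd r hr x, ← hqe r hr x]
      ring
    rw [← e1]
    have e2 : (derivative g).eval x = c1 * (h.eval x + x * (derivative h).eval x) +
        c0 * (derivative h).eval x + (derivative g'').eval x := by
      conv_lhs => rw [hgx]
      simp [-derivative_mul, mul_assoc, derivative_mul]
    have e3 : g.eval x = c1 * x * h.eval x + c0 * h.eval x + g''.eval x := by
      conv_lhs => rw [hgx]
      simp
    rw [e2, e3]; ring
  have hc1l : g.coeff (d + 1) * h.leadingCoeff = c1 * h.leadingCoeff ^ 2 := by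
    rw [hc1]; field_simp
  have hl2 : 0 < h.leadingCoeff ^ 2 := by positivity
  have hc1nn : 0 ≤ c1 := by
    rw [hc1l] at hlc; exact nonneg_of_mul_nonneg_left hlc hl2
  have hrneg : ∀ r ∈ s, 0 < -(g.eval r / (derivative h).eval r) := fun r hr => by
    have h1 := hgh r ((hmem r).1 hr)
    have h2 := hd r ((hmem r).1 hr)
    have : g.eval r / (derivative h).eval r =
      g.eval r * (derivative h).eval r / (derivative h).eval r ^ 2 := by field_simp
    rw [this, ← neg_div]
    exact div_pos (by linarith) (by positivity)
  rw [key]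
  have hsum : ∀ r ∈ s, 0 ≤ -(g.eval r / (derivative h).eval r) * (q r).eval x ^ 2 :=
    fun r hr => mul_nonneg (hrneg r hr).le (sq_nonneg _)
  have hsum0 := Finset.sum_nonneg hsum
  have hterm : (∃ r ∈ s, (q r).eval x ≠ 0) → 0 < c1 * h.eval x ^ 2 +
        ∑ r ∈ s, -(g.eval r / (derivative h).eval r) * (q r).eval x ^ 2 := by
    rintro ⟨r, hr, hne⟩
    have h1 : 0 < -(g.eval r / (derivative h).eval r) * (q r).eval x ^ 2 :=
      mul_pos (hrneg r hr) (by positivity)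
    have h2 := Finset.single_le_sum hsum hr
    have h3 : 0 ≤ c1 * h.eval x ^ 2 := by positivity
    linarith
  by_cases hx : h.eval x = 0
  · exact hterm ⟨x, (hmem x).2 hx, by rw [hqself x ((hmem x).2 hx)]; exact hd x hx⟩
  rcases s.eq_empty_or_nonempty with hse | ⟨r, hr⟩
  · have hd0 : d = 0 := by rw [← hcard, hse, Finset.card_empty]
    have h4 := hpos hd0
    rw [hc1l] at h4
    have : 0 < c1 := pos_of_mul_pos_left h4 hl2.le
    have h5 : 0 < c1 * h.eval x ^ 2 := by positivity
    linarith
  · refine hterm ⟨r, hr, fun h1 => hx ?_⟩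
    rw [← hqe r hr x, h1, mul_zero]

/-! ### Hurwitz polynomials and their odd parts -/

theorem Multiset.norm_prod_map_le_and_lt {m : Multiset ℂ} {f g : ℂ → ℂ}
    (h : ∀ r ∈ m, ‖f r‖ < ‖g r‖) :
    ‖(m.map f).prod‖ ≤ ‖(m.map g).prod‖ ∧ (m ≠ 0 → ‖(m.map f).prod‖ < ‖(m.map g).prod‖) := by
  induction m using Multiset.induction_on with
  | empty => simp
  | cons a m ih =>
    have ih := ih fun r hr => h r (Multiset.mem_cons_of_mem hr)
    have ha := h a (Multiset.mem_cons_self a m)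
    have hg : 0 < ‖(m.map g).prod‖ := by
      rw [norm_pos_iff]
      refine Multiset.prod_ne_zero fun h0 => ?_
      obtain ⟨r, hr, hr0⟩ := Multiset.mem_map.1 h0
      have := h r (Multiset.mem_cons_of_mem hr)
      rw [hr0, norm_zero] at this
      exact absurd (norm_nonneg (f r)) (by linarith)
    have hlt : ‖((a ::ₘ m).map f).prod‖ < ‖((a ::ₘ m).map g).prod‖ := by
      rw [Multiset.map_cons, Multiset.map_cons, Multiset.prod_cons, Multiset.prod_cons, norm_mul,
        norm_mul]
      calc ‖f a‖ * ‖(m.map f).prod‖ ≤ ‖f a‖ * ‖(m.map g).prod‖ := by gcongr; exact ih.1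
        _ < ‖g a‖ * ‖(m.map g).prod‖ := by gcongr
    exact ⟨hlt.le, fun _ => hlt⟩

/-- All complex zeros lie in the open left half-plane. -/
def IsHurwitz (S : ℝ[X]) : Prop :=
  ∀ z : ℂ, (S.map (algebraMap ℝ ℂ)).eval z = 0 → z.re < 0

/-- A root in the left half-plane is closer to the mirror image -z̄ than to z; multiply over the
roots. -/
theorem Polynomial.norm_eval_neg_conj_lt {S : ℂ[X]} (hdeg : S.natDegree ≠ 0)
    (hS : ∀ z, S.eval z = 0 → z.re < 0) {z : ℂ} (hz : 0 < z.re) :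
    ‖S.eval (-(starRingEnd ℂ) z)‖ < ‖S.eval z‖ := by
  have hs : S.Splits := IsAlgClosed.splits S
  have hS0 : S ≠ 0 := by rintro rfl; simp at hdeg
  rw [hs.eval_eq_prod_roots, hs.eval_eq_prod_roots, norm_mul, norm_mul]
  refine mul_lt_mul_of_pos_left ?_ (norm_pos_iff.2 (leadingCoeff_ne_zero.2 hS0))
  refine (Multiset.norm_prod_map_le_and_lt fun r hr => ?_).2 (hs.roots_ne_zero hdeg)
  have hr' := hS r (mem_roots'.1 hr).2
  rw [Complex.norm_def, Complex.norm_def]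
  refine Real.sqrt_lt_sqrt (Complex.normSq_nonneg _) ?_
  simp only [Complex.normSq_apply, Complex.sub_re, Complex.sub_im, Complex.neg_re, Complex.neg_im,
    Complex.conj_re, Complex.conj_im]
  nlinarith

theorem Multiset.re_sum_map_pos {m : Multiset ℂ} {f : ℂ → ℂ} (hm : m ≠ 0)
    (h : ∀ r ∈ m, 0 < (f r).re) : 0 < ((m.map f).sum).re := by
  induction m using Multiset.induction_on with
  | empty => exact absurd rfl hm
  | cons a m ih =>
    have ha := h a (Multiset.mem_cons_self a m)
    rw [Multiset.map_cons, Multiset.sum_cons, Complex.add_re]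
    rcases eq_or_ne m 0 with rfl | hm'
    · simpa using ha
    · exact add_pos ha (ih hm' fun r hr => h r (Multiset.mem_cons_of_mem hr))

/-- S'/S = ∑ 1/(z - r), and each term has positive real part. -/
theorem Polynomial.re_logDeriv_pos {S : ℂ[X]} (hdeg : S.natDegree ≠ 0)
    (hS : ∀ z, S.eval z = 0 → z.re < 0) {z : ℂ} (hz : 0 ≤ z.re) :
    0 < ((derivative S).eval z / S.eval z).re := by
  have hs : S.Splits := IsAlgClosed.splits S
  have hz0 : S.eval z ≠ 0 := fun h => absurd (hS z h) (not_lt.2 hz)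
  rw [hs.eval_derivative_div_eval_of_ne_zero hz0]
  refine Multiset.re_sum_map_pos (hs.roots_ne_zero hdeg) fun r hr => ?_
  have hr' := hS r (mem_roots'.1 hr).2
  have h1 : 0 < (z - r).re := by simp; linarith
  rw [one_div, Complex.inv_re]
  exact div_pos h1 (Complex.normSq_pos.2 fun h => by simp [h] at h1)

theorem Polynomial.expand_contract_add_X_mul_expand_contract (S : ℝ[X]) :
    S = expand ℝ 2 (contract 2 S) + X * expand ℝ 2 (contract 2 (divX S)) := by
  ext k
  rw [coeff_add]
  rcases Nat.even_or_odd' k with ⟨j, rfl | rfl⟩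
  · have : (X * expand ℝ 2 (contract 2 (divX S))).coeff (2 * j) = 0 := by
      rcases j with _ | j
      · simp
      · rw [show 2 * (j + 1) = (2 * j + 1) + 1 by ring, coeff_X_mul, coeff_expand two_pos,
          if_neg (by omega)]
    rw [this, coeff_expand_mul' two_pos, coeff_contract two_ne_zero, mul_comm, add_zero]
  · rw [coeff_X_mul, coeff_expand_mul' two_pos, coeff_contract two_ne_zero, coeff_divX,
      coeff_expand two_pos, if_neg (by omega), zero_add, mul_comm]

theorem eval_map_eq_even_add_odd {S e o : ℝ[X]} (hS : S = expand ℝ 2 e + X * expand ℝ 2 o) (z : ℂ) :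
    (S.map (algebraMap ℝ ℂ)).eval z =
    (e.map (algebraMap ℝ ℂ)).eval (z ^ 2) + z * (o.map (algebraMap ℝ ℂ)).eval (z ^ 2) := by
  rw [hS]
  simp [map_expand, expand_eval]

theorem Polynomial.eval_map_conj (S : ℝ[X]) (z : ℂ) :
    (S.map (algebraMap ℝ ℂ)).eval ((starRingEnd ℂ) z) =
      (starRingEnd ℂ) ((S.map (algebraMap ℝ ℂ)).eval z) := by
  rw [eval_map_algebraMap, eval_map_algebraMap, aeval_conj]

/-- The derivative of `S` on the imaginary axis at a zero of the odd part. -/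
theorem eval_derivative_at_oddPart_zero {S e o : ℝ[X]}
    (hS : S = expand ℝ 2 e + X * expand ℝ 2 o) {s : ℝ} (hz : o.eval (-s ^ 2) = 0) :
    ((derivative S).map (algebraMap ℝ ℂ)).eval (s * Complex.I) =
      ((-2 * s ^ 2 * (derivative o).eval (-s ^ 2) : ℝ) : ℂ) +
        ((2 * s * (derivative e).eval (-s ^ 2) : ℝ) : ℂ) * Complex.I := by
  have h2 : ((s : ℂ) * Complex.I) ^ 2 = ((-s ^ 2 : ℝ) : ℂ) := by
    rw [mul_pow, Complex.I_sq]; push_cast; ring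
  have hd : derivative S = X * (2 * expand ℝ 2 (derivative e)) + expand ℝ 2 o +
      X ^ 2 * (2 * expand ℝ 2 (derivative o)) := by
    rw [hS, derivative_add, derivative_mul, derivative_expand, derivative_expand, derivative_X]
    push_cast
    ring
  rw [hd]
  simp only [Polynomial.map_add, Polynomial.map_mul, map_expand, eval_add, eval_mul, expand_eval,
    map_X, eval_X, Polynomial.map_pow, eval_pow, h2, eval_map_algebraMap_ofReal, hz,
    Polynomial.map_ofNat, eval_ofNat]
  push_cast
  ring

/-- If z² = μ with Re z > 0, then S(z) = e(μ) = S(-z), while |S(-z)| = |S(-z̄)| because S is real;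
this contradicts `norm_eval_neg_conj_lt`. So both square roots of μ are imaginary. The value μ = 0
is excluded because S'(0) = o(0) would vanish. -/
theorem IsHurwitz.oddPart_zero {S e o : ℝ[X]} (hS : S = expand ℝ 2 e + X * expand ℝ 2 o)
    (hH : IsHurwitz S) (hdeg : S.natDegree ≠ 0) {μ : ℂ}
    (hμ : (o.map (algebraMap ℝ ℂ)).eval μ = 0) : ∃ s : ℝ, 0 < s ∧ μ = ((-s ^ 2 : ℝ) : ℂ) := by
  have hdeg' : (S.map (algebraMap ℝ ℂ)).natDegree ≠ 0 := by rwa [natDegree_map]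
  have main : ∀ z : ℂ, z ^ 2 = μ → ¬ 0 < z.re := by
    intro z hz hre
    have h1 := norm_eval_neg_conj_lt hdeg' hH hre
    rw [← map_neg, eval_map_conj, Complex.norm_conj, eval_map_eq_even_add_odd hS,
      eval_map_eq_even_add_odd hS, neg_sq, hz, hμ] at h1
    simp at h1
  obtain ⟨z, hz⟩ := IsAlgClosed.exists_pow_nat_eq μ two_pos
  have hre : z.re = 0 := by
    refine le_antisymm (not_lt.1 (main z hz)) ?_
    have := main (-z) (by rw [neg_sq, hz])
    simpa using this
  have hzI : z = z.im * Complex.I := Complex.ext (by simp [hre]) (by simp)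
  have hμ' : μ = ((-|z.im| ^ 2 : ℝ) : ℂ) := by
    rw [← hz, sq_abs, hzI, mul_pow, Complex.I_sq]; simp
  refine ⟨|z.im|, abs_pos.2 fun h0 => ?_, hμ'⟩
  have hμ0 : μ = 0 := by rw [hμ', h0]; simp
  have ho : o.eval 0 = 0 := by
    rw [hμ0, ← Complex.ofReal_zero, eval_map_algebraMap_ofReal] at hμ
    exact_mod_cast hμ
  have h2 := re_logDeriv_pos hdeg' hH (z := 0) le_rfl
  have h3 := eval_derivative_at_oddPart_zero hS (s := 0) (by simpa using ho)
  rw [derivative_map] at h2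
  simp only [Complex.ofReal_zero, zero_mul] at h3
  rw [h3] at h2
  simp at h2

/-- At the point is one has S'/S with real part -2s²o'(-s²)/e(-s²), which is positive by
`re_logDeriv_pos`. -/
theorem IsHurwitz.oddPart_derivative_mul_evenPart_neg {S e o : ℝ[X]}
    (hS : S = expand ℝ 2 e + X * expand ℝ 2 o)
    (hH : IsHurwitz S) (hdeg : S.natDegree ≠ 0) {s : ℝ} (hz : o.eval (-s ^ 2) = 0) :
    (derivative o).eval (-s ^ 2) * e.eval (-s ^ 2) < 0 := by
  have hdeg' : (S.map (algebraMap ℝ ℂ)).natDegree ≠ 0 := by rwa [natDegree_map]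
  have h2 := re_logDeriv_pos hdeg' hH (z := s * Complex.I) (by simp)
  have hsq : ((s : ℂ) * Complex.I) ^ 2 = ((-s ^ 2 : ℝ) : ℂ) := by
    rw [mul_pow, Complex.I_sq]; push_cast; ring
  rw [derivative_map, eval_derivative_at_oddPart_zero hS hz, eval_map_eq_even_add_odd hS, hsq,
    eval_map_algebraMap_ofReal, eval_map_algebraMap_ofReal, hz, Complex.ofReal_zero, mul_zero,
    add_zero, Complex.div_ofReal_re] at h2
  simp only [Complex.add_re, Complex.ofReal_re, Complex.mul_re, Complex.I_re, Complex.I_im,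
    Complex.ofReal_im, mul_zero, zero_mul, sub_zero, add_zero] at h2
  set a := (derivative o).eval (-s ^ 2)
  set b := e.eval (-s ^ 2)
  have hb : b ≠ 0 := by rintro hb; simp [hb] at h2
  have hb2 : 0 < b ^ 2 := by positivity
  have h4 : 0 < -2 * s ^ 2 * a * b := by
    have := mul_pos h2 hb2
    have e1 : -2 * s ^ 2 * a / b * b ^ 2 = -2 * s ^ 2 * a * b := by field_simp
    rwa [e1] at this
  by_contra! h5
  nlinarith [mul_nonneg (sq_nonneg s) h5]

/-! ### The beta integral as a positive functional -/

open MeasureTheory in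
theorem intervalIntegrable_beta_weight {A B : ℝ} (hA : 0 < A) (hB : 0 < B) :
    IntervalIntegrable (fun t : ℝ => ((t ^ (A - 1) * (1 - t) ^ (B - 1) : ℝ) : ℂ)) volume 0 1 := by
  refine (Complex.betaIntegral_convergent (u := A) (v := B) (by simpa) (by simpa)).congr ?_
  intro t ht
  rw [Set.uIoc_of_le zero_le_one] at ht
  have h1 : (0 : ℝ) ≤ 1 - t := by linarith [ht.2]
  simp only
  push_cast
  rw [Complex.ofReal_cpow ht.1.le, Complex.ofReal_cpow h1]
  push_cast
  rfl

open MeasureTheory in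
theorem intervalIntegrable_eval_mul_beta_weight {A B : ℝ} (hA : 0 < A) (hB : 0 < B) (h : ℂ[X]) :
    IntervalIntegrable (fun t : ℝ => h.eval (t : ℂ) * ((t ^ (A - 1) * (1 - t) ^ (B - 1) : ℝ) : ℂ))
      volume 0 1 :=
  (intervalIntegrable_beta_weight hA hB).continuousOn_mul
    (h.continuous.comp Complex.continuous_ofReal).continuousOn

/-- A positive linear functional on polynomials that integrates by parts like
`h ↦ ∫ t in 0..1, h t * t ^ (A - 1) * (1 - t) ^ (B - 1)`. -/
structure IsBetaFunctional (A B : ℝ) (M : ℂ[X] →ₗ[ℂ] ℂ) : Prop where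
  conj : ∀ h, M (h.map (starRingEnd ℂ)) = (starRingEnd ℂ) (M h)
  pos : ∀ q : ℝ[X], (∀ t ∈ Set.Ioo (0 : ℝ) 1, 0 < q.eval t) → ∀ p : ℂ[X], p ≠ 0 →
    0 < (M (q.map (algebraMap ℝ ℂ) * (p * p.map (starRingEnd ℂ)))).re
  parts : ∀ h, M (X * (1 - X) * derivative h + (C (A : ℂ) * (1 - X) - C (B : ℂ) * X) * h) = 0

open MeasureTheory in
theorem exists_isBetaFunctional {A B : ℝ} (hA : 0 < A) (hB : 0 < B) :
    ∃ M : ℂ[X] →ₗ[ℂ] ℂ, IsBetaFunctional A B M := by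
  let w : ℝ → ℝ := fun t => t ^ (A - 1) * (1 - t) ^ (B - 1)
  have hint : ∀ h : ℂ[X], IntervalIntegrable (fun t : ℝ => h.eval (t : ℂ) * ((w t : ℝ) : ℂ))
      volume 0 1 := intervalIntegrable_eval_mul_beta_weight hA hB
  let M : ℂ[X] →ₗ[ℂ] ℂ :=
    { toFun := fun h => ∫ t in (0 : ℝ)..1, h.eval (t : ℂ) * ((w t : ℝ) : ℂ)
      map_add' := fun f g => by
        rw [← intervalIntegral.integral_add (hint f) (hint g)]
        simp only [eval_add, add_mul]
      map_smul' := fun c f => by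
        rw [RingHom.id_apply, smul_eq_mul, ← intervalIntegral.integral_const_mul]
        simp only [eval_smul, smul_eq_mul, mul_assoc] }
  have hM : ∀ h, M h = ∫ t in (0 : ℝ)..1, h.eval (t : ℂ) * ((w t : ℝ) : ℂ) := fun h => rfl
  have hconj : ∀ (h : ℂ[X]) (t : ℝ), (h.map (starRingEnd ℂ)).eval (t : ℂ) =
      (starRingEnd ℂ) (h.eval (t : ℂ)) := fun h t => by
    conv_lhs => rw [← Complex.conj_ofReal t]
    rw [eval_map_apply]
  have hw : ∀ t ∈ Set.Ioo (0 : ℝ) 1, 0 < w t := fun t ht =>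
    mul_pos (Real.rpow_pos_of_pos ht.1 _) (Real.rpow_pos_of_pos (by linarith [ht.2]) _)
  refine ⟨M, ⟨fun h => ?_, fun q hq p hp => ?_, fun h => ?_⟩⟩
  · rw [hM, hM, intervalIntegral.integral_of_le zero_le_one,
      intervalIntegral.integral_of_le zero_le_one, ← integral_conj]
    refine integral_congr_ae (Filter.Eventually.of_forall fun t => ?_)
    simp only [hconj, map_mul, Complex.conj_ofReal]
  · let F : ℝ → ℝ := fun t => q.eval t * Complex.normSq (p.eval (t : ℂ)) * w t
    have hF : ∀ t : ℝ, (q.map (algebraMap ℝ ℂ) * (p * p.map (starRingEnd ℂ))).eval (t : ℂ) *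
        ((w t : ℝ) : ℂ) = ((F t : ℝ) : ℂ) := fun t => by
      rw [eval_mul, eval_mul, eval_map_algebraMap_ofReal, hconj, Complex.mul_conj]
      push_cast [F]
      ring
    have hFint : IntervalIntegrable F volume 0 1 := by
      have h1 := hint (q.map (algebraMap ℝ ℂ) * (p * p.map (starRingEnd ℂ)))
      simp only [hF] at h1
      have h2 : Integrable F (volume.restrict (Set.Ioc 0 1)) := by simpa using h1.1.re
      exact ⟨h2, by simp⟩
    rw [hM]
    simp only [hF]
    rw [intervalIntegral.integral_ofReal, Complex.ofReal_re]
    have hnn : 0 ≤ᵐ[volume.restrict (Set.uIoc 0 1)] F := by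
      rw [Set.uIoc_of_le zero_le_one, ← restrict_Ioo_eq_restrict_Ioc]
      refine (ae_restrict_iff' measurableSet_Ioo).2 (Filter.Eventually.of_forall fun t ht => ?_)
      exact mul_nonneg (mul_nonneg (hq t ht).le (Complex.normSq_nonneg _)) (hw t ht).le
    rw [intervalIntegral.integral_pos_iff_support_of_nonneg_ae' hnn hFint]
    refine ⟨zero_lt_one, ?_⟩
    -- The integrand is positive off the finitely many zeros of `p`, hence almost everywhere on (0,
    -- 1).
    have hfin : {t : ℝ | p.eval (t : ℂ) = 0}.Finite := by
      refine Set.Finite.preimage (f := fun t : ℝ => (t : ℂ)) (s := {z | p.eval z = 0})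
        Complex.ofReal_injective.injOn ?_
      refine (p.roots.toFinset.finite_toSet).subset fun z hz => ?_
      simpa [hp] using hz
    have hsub : Set.Ioo (0 : ℝ) 1 \ {t : ℝ | p.eval (t : ℂ) = 0} ⊆
        Function.support F ∩ Set.Ioc 0 1 := by
      rintro t ⟨ht, ht0⟩
      refine ⟨?_, ht.1, ht.2.le⟩
      exact (mul_pos (mul_pos (hq t ht) (Complex.normSq_pos.2 ht0)) (hw t ht)).ne'
    refine lt_of_lt_of_le ?_ (measure_mono hsub)
    rw [measure_sdiff_null (hfin.measure_zero _)]
    simp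
  · rw [hM]
    -- This primitive vanishes at both endpoints because A, B > 0.
    let G : ℝ → ℂ := fun t => h.eval (t : ℂ) * ((t ^ A * (1 - t) ^ B : ℝ) : ℂ)
    have hG : ∫ t in (0 : ℝ)..1, (X * (1 - X) * derivative h +
        (C (A : ℂ) * (1 - X) - C (B : ℂ) * X) * h).eval (t : ℂ) * ((w t : ℝ) : ℂ) = G 1 - G 0 := by
      refine intervalIntegral.integral_eq_sub_of_hasDerivAt_of_le zero_le_one ?_ ?_ (hint _)
      · refine ContinuousOn.mul (h.continuous.comp Complex.continuous_ofReal).continuousOn ?_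
        refine Complex.continuous_ofReal.comp_continuousOn ?_
        refine ContinuousOn.mul ?_ ?_
        · exact (Real.continuous_rpow_const hA.le).continuousOn
        · exact ((Real.continuous_rpow_const hB.le).comp (by fun_prop)).continuousOn
      · intro t ht
        have ht1 : 0 < 1 - t := by linarith [ht.2]
        have d1 : HasDerivAt (fun t : ℝ => h.eval (t : ℂ)) ((derivative h).eval (t : ℂ)) t :=
          (h.hasDerivAt (t : ℂ)).comp_ofReal
        have d2 : HasDerivAt (fun t : ℝ => t ^ A) (A * t ^ (A - 1)) t :=
          Real.hasDerivAt_rpow_const (Or.inl ht.1.ne')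
        have d3 : HasDerivAt (fun t : ℝ => (1 - t) ^ B) (-1 * B * (1 - t) ^ (B - 1)) t :=
          ((hasDerivAt_id t).const_sub 1).rpow_const (Or.inl ht1.ne')
        refine (d1.mul (d2.mul d3).ofReal_comp).congr_deriv ?_
        have e1 : t ^ A = t ^ (A - 1) * t := by
          rw [← Real.rpow_add_one ht.1.ne', sub_add_cancel]
        have e2 : (1 - t) ^ B = (1 - t) ^ (B - 1) * (1 - t) := by
          rw [← Real.rpow_add_one ht1.ne', sub_add_cancel]
        simp [w, e1, e2]
        ring
    rw [hG]
    simp [G, Real.zero_rpow hA.ne', Real.zero_rpow hB.ne']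

/-! ### Orthogonality of hypergeometric eigenfunctions -/

/-- The hypergeometric differential operator whose polynomial eigenfunctions are
orthogonal for the weight `t ^ (A - 1) * (1 - t) ^ B`. -/
noncomputable def hypergeometricOp (A B : ℝ) (q : ℂ[X]) : ℂ[X] :=
  X * (1 - X) * derivative (derivative q) + (C (A : ℂ) - C (A + B + 1 : ℂ) * X) * derivative q

namespace IsBetaFunctional

variable {A B : ℝ} {M : ℂ[X] →ₗ[ℂ] ℂ}

/-- The difference of the two sides is a total derivative: it is `parts` for (1 - X)(q'T - qT'). -/
theorem hypergeometricOp_symm (hM : IsBetaFunctional A B M) (q T : ℂ[X]) :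
    M ((1 - X) * (hypergeometricOp A B q * T)) = M ((1 - X) * (q * hypergeometricOp A B T)) := by
  rw [← sub_eq_zero, ← map_sub, ← hM.parts ((1 - X) * (derivative q * T - q * derivative T))]
  congr 1
  simp only [hypergeometricOp, derivative_mul, derivative_sub, derivative_one, derivative_X,
    C_add, C_1]
  ring

theorem _root_.hypergeometricOp_X_pow (A B : ℝ) (k : ℕ) :
    hypergeometricOp A B (X ^ k) =
      C ((k : ℂ) * (k - 1 + A)) * X ^ (k - 1) - C ((k : ℂ) * (k + A + B)) * X ^ k := by
  rcases k with _ | _ | k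
  · simp [hypergeometricOp]
  · simp [hypergeometricOp]
    ring
  · simp only [hypergeometricOp, derivative_X_pow, derivative_C_mul, Nat.add_sub_cancel]
    simp only [Nat.cast_add, Nat.cast_one, C_add, C_mul, C_1, C_sub]
    ring

/-- The operator maps X^k to a combination of X^k and X^(k-1), so symmetry and induction leave the
moment times the eigenvalue gap (d - k)(d + k + A + B), which is nonzero for k < d. -/
theorem eigenfunction_orthogonal (hM : IsBetaFunctional A B M) (hAB : 0 < A + B) {d : ℕ} {v : ℂ[X]}
    (hv : hypergeometricOp A B v = -C ((d : ℂ) * (d + A + B)) * v) {k : ℕ} (hk : k < d) :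
    M ((1 - X) * (v * X ^ k)) = 0 := by
  induction k with
  | zero =>
    have h := hM.hypergeometricOp_symm v (X ^ 0)
    rw [hv, hypergeometricOp_X_pow] at h
    have e1 : (1 - X) * (-C ((d : ℂ) * (d + A + B)) * v * X ^ 0) =
      (-((d : ℂ) * (d + A + B))) • ((1 - X) * (v * X ^ 0)) := by
      rw [smul_eq_C_mul, C_neg]; ring
    rw [e1, map_smul] at h
    simp only [Nat.cast_zero, zero_mul, sub_zero, mul_zero, map_zero, smul_eq_mul] at h
    refine (mul_eq_zero.1 h).resolve_left (neg_ne_zero.2 ?_)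
    have : (0 : ℝ) < d * (d + A + B) := by
      have : (0 : ℝ) < d := by exact_mod_cast hk
      exact mul_pos this (by linarith)
    exact_mod_cast this.ne'
  | succ k ih =>
    have ih := ih (by omega)
    have h := hM.hypergeometricOp_symm v (X ^ (k + 1))
    rw [hv, hypergeometricOp_X_pow] at h
    have e1 : (1 - X) * (-C ((d : ℂ) * (d + A + B)) * v * X ^ (k + 1)) =
      (-((d : ℂ) * (d + A + B))) • ((1 - X) * (v * X ^ (k + 1))) := by
      rw [smul_eq_C_mul, C_neg]; ring
    have e2 : (1 - X) * (v * (C (((k + 1 : ℕ) : ℂ) * (((k + 1 : ℕ) : ℂ) - 1 + A)) * X ^ (k + 1 - 1)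
        - C (((k + 1 : ℕ) : ℂ) * (((k + 1 : ℕ) : ℂ) + A + B)) * X ^ (k + 1))) =
      (((k + 1 : ℕ) : ℂ) * (((k + 1 : ℕ) : ℂ) - 1 + A)) • ((1 - X) * (v * X ^ k)) -
      (((k + 1 : ℕ) : ℂ) * (((k + 1 : ℕ) : ℂ) + A + B)) • ((1 - X) * (v * X ^ (k + 1))) := by
      rw [smul_eq_C_mul, smul_eq_C_mul, Nat.add_sub_cancel]; ring
    rw [e1, e2, map_sub, map_smul, map_smul, map_smul, ih] at h
    simp only [smul_eq_mul, mul_zero, zero_sub] at h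
    have h' : ((((d : ℝ) - (k + 1)) * (d + (k + 1) + A + B) : ℝ) : ℂ) *
        M ((1 - X) * (v * X ^ (k + 1))) = 0 := by
      push_cast at h ⊢
      linear_combination -h
    refine (mul_eq_zero.1 h').resolve_left ?_
    have h1 : (k : ℝ) + 1 < d := by exact_mod_cast hk
    have : (0 : ℝ) < ((d : ℝ) - (k + 1)) * (d + (k + 1) + A + B) := by
      have : (0 : ℝ) ≤ k := k.cast_nonneg
      exact mul_pos (by linarith) (by linarith)
    exact_mod_cast this.ne'

/-- Against an eigenfunction of degree index `d`, only the coefficient of `X ^ d` counts. -/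
theorem eigenfunction_apply (hM : IsBetaFunctional A B M) (hAB : 0 < A + B) {d : ℕ} {v : ℂ[X]}
    (hv : hypergeometricOp A B v = -C ((d : ℂ) * (d + A + B)) * v) {T : ℂ[X]}
    (hT : T.natDegree ≤ d) :
    M ((1 - X) * (v * T)) = T.coeff d * M ((1 - X) * (v * X ^ d)) := by
  have e : (1 - X) * (v * T) =
      ∑ k ∈ Finset.range (d + 1), T.coeff k • ((1 - X) * (v * X ^ k)) := by
    conv_lhs => rw [T.as_sum_range' (d + 1) (by omega)]
    rw [Finset.mul_sum, Finset.mul_sum]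
    refine Finset.sum_congr rfl fun k _ => ?_
    rw [smul_eq_C_mul, ← C_mul_X_pow_eq_monomial]
    ring
  rw [e, map_sum, Finset.sum_range_succ, Finset.sum_eq_zero, zero_add, map_smul, smul_eq_mul]
  intro k hk
  rw [map_smul, hM.eigenfunction_orthogonal hAB hv (Finset.mem_range.1 hk), smul_zero]

end IsBetaFunctional

/-! ### The half-plane estimate -/

/-- For `deg R ≤ n`, the equation `f - ζ f' = R` has a polynomial solution with
`f 0 = ∑ k! ζ ^ k R_k`. -/
theorem exists_sub_derivative_eq (ζ : ℂ) {n : ℕ} {R : ℂ[X]} (hR : R.natDegree ≤ n) :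
    ∃ f : ℂ[X], f.natDegree ≤ n ∧ f - C ζ * derivative f = R ∧
      f.coeff 0 = ∑ k ∈ Finset.range (n + 1), (k.factorial : ℂ) * R.coeff k * ζ ^ k := by
  refine ⟨∑ j ∈ Finset.range (n + 1), C (ζ ^ j) * derivative^[j] R, ?_, ?_, ?_⟩
  · refine natDegree_sum_le_of_forall_le _ _ fun j _ => ?_
    exact (natDegree_C_mul_le _ _).trans
      ((natDegree_iterate_derivative R j).trans ((Nat.sub_le _ _).trans hR))
  · have h := Finset.sum_range_sub' (fun j => C (ζ ^ j) * derivative^[j] R) (n + 1)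
    rw [iterate_derivative_eq_zero (by omega : R.natDegree < n + 1)] at h
    rw [derivative_sum, Finset.mul_sum, ← Finset.sum_sub_distrib]
    simp only [pow_zero, C_1, one_mul, Function.iterate_zero, id_eq, mul_zero, sub_zero] at h
    refine (Finset.sum_congr rfl fun j _ => ?_).trans h
    rw [derivative_C_mul, Function.iterate_succ_apply', pow_succ, C_mul]
    ring
  · rw [finsetSum_coeff]
    refine Finset.sum_congr rfl fun j _ => ?_
    rw [coeff_C_mul, coeff_iterate_derivative, zero_add, Nat.descFactorial_self, nsmul_eq_mul]
    ring

/-- With w = v + ρu and R = Xw, the hypothesis `hz` says f(0) = 0. As R(0) = 0, also f'(0) = 0, so f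
= X²p and w = Xp - ζ(2p + Xp'). Pairing with p̄ kills v and gives K - ζL = -cρ, with K > 0 and Re L
> 0. Hence Re(cρ/ζ) = Re L - K Re(1/ζ) > 0. -/
theorem IsBetaFunctional.re_div_pos_of_zero {A B : ℝ} {M : ℂ[X] →ₗ[ℂ] ℂ}
    (hM : IsBetaFunctional A B M) (hA : A < 4) (hB : 0 < B) {m : ℕ} {u v : ℂ[X]} {κ ρ ζ : ℂ} {c : ℝ}
    (hv : ∀ T : ℂ[X], T.natDegree ≤ m → M ((1 - X) * (v * T)) = 0)
    (hu : ∀ T : ℂ[X], T.natDegree ≤ m → M ((1 - X) * (u * T)) = T.coeff m * κ)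
    (hdeg : (v + C ρ * u).natDegree ≤ m + 1) (hc : 0 < c)
    (hκ : (starRingEnd ℂ) ((v + C ρ * u).coeff (m + 1)) * κ = -(c : ℂ))
    (hζ : ζ.re ≤ 0) (hζ0 : ζ ≠ 0)
    (hz : ∑ k ∈ Finset.range (m + 2 + 1),
      (k.factorial : ℂ) * (X * (v + C ρ * u)).coeff k * ζ ^ k = 0) :
    0 < (ρ / ζ).re := by
  set w := v + C ρ * u with hw
  have hRdeg : (X * w).natDegree ≤ m + 2 := by
    refine natDegree_mul_le.trans ?_
    rw [natDegree_X]; omega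
  obtain ⟨f, hfd, hf, hf0⟩ := exists_sub_derivative_eq ζ hRdeg
  rw [hz] at hf0
  have hf1 : f.coeff 1 = 0 := by
    have := congrArg (fun g => coeff g 0) hf
    simp only [coeff_sub, coeff_derivative, hf0, mul_coeff_zero, coeff_X_zero,
      zero_mul] at this
    simpa [hζ0] using this
  obtain ⟨p, hp⟩ : X ^ 2 ∣ f := by
    rw [X_pow_dvd_iff]
    intro d hd
    interval_cases d <;> assumption
  have hpm : p.coeff m = w.coeff (m + 1) := by
    have h1 : f.coeff (m + 2) = p.coeff m := by rw [hp, mul_comm, coeff_mul_X_pow]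
    have h2 := congrArg (fun g => coeff g (m + 2)) hf
    simp only [coeff_sub, coeff_C_mul, coeff_derivative] at h2
    rw [coeff_eq_zero_of_natDegree_lt (p := f) (n := m + 2 + 1) (by omega), coeff_X_mul] at h2
    rw [← h1, ← h2]; ring
  have hpd : p.natDegree ≤ m := by
    rw [natDegree_le_iff_coeff_eq_zero]
    intro N hN
    rw [← coeff_mul_X_pow p 2 N, mul_comm, ← hp]
    exact coeff_eq_zero_of_natDegree_lt (by omega)
  have hp0 : p ≠ 0 := by
    rintro rfl
    rw [coeff_zero] at hpm
    rw [← hpm, map_zero, zero_mul, eq_comm, neg_eq_zero] at hκ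
    exact hc.ne' (by exact_mod_cast hκ)
  have hwp : w = X * p - C ζ * (2 * p + X * derivative p) := by
    refine mul_left_cancel₀ (X_ne_zero (R := ℂ)) ?_
    rw [← hf, hp, derivative_mul, derivative_X_pow]
    push_cast
    simp only [map_ofNat]
    ring
  set pb := p.map (starRingEnd ℂ) with hpb
  have hpbp : pb.map (starRingEnd ℂ) = p := by
    rw [hpb, Polynomial.map_map]
    ext k; simp
  have hpbd : pb.natDegree ≤ m := natDegree_map_le.trans hpd
  have hlhs : M ((1 - X) * (w * pb)) = ρ * -(c : ℂ) := by
    have e : (1 - X) * (w * pb) = (1 - X) * (v * pb) + ρ • ((1 - X) * (u * pb)) := by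
      rw [hw, smul_eq_C_mul]; ring
    rw [e, map_add, map_smul, hv _ hpbd, hu _ hpbd, smul_eq_mul, zero_add, hpb, coeff_map, hpm, hκ]
  have hK := hM.pos (X * (1 - X)) (fun t ht => by
    simpa using mul_pos ht.1 (sub_pos.2 ht.2)) p hp0
  have hL := hM.pos (C (4 - A) * (1 - X) + C B * X) (fun t ht => by
    simpa using add_pos (mul_pos (sub_pos.2 hA) (sub_pos.2 ht.2)) (mul_pos hB ht.1)) p hp0
  rw [← hpb] at hK hL
  set K := M ((X * (1 - X) : ℝ[X]).map (algebraMap ℝ ℂ) * (p * pb)) with hKdef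
  set L := M ((1 - X) * ((2 * p + X * derivative p) * pb)) with hLdef
  have hKreal : (starRingEnd ℂ) K = K := by
    rw [hKdef, ← hM.conj]
    congr 1
    simp only [Polynomial.map_mul, Polynomial.map_sub, Polynomial.map_one, map_X, hpbp, ← hpb]
    ring
  have hKL : K - ζ * L = ρ * -(c : ℂ) := by
    rw [← hlhs, hKdef, hLdef, ← smul_eq_mul ζ, ← map_smul, ← map_sub, hwp, smul_eq_C_mul]
    congr 1
    simp only [Polynomial.map_mul, Polynomial.map_sub, Polynomial.map_one, map_X]
    ring
  -- Integrating (1 - X)X(pp̄)' by parts turns 2 Re L into the functional at ((4 - A)(1 - X) +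
  -- BX)pp̄; this is where A < 4, that is α < 2, is needed.
  have hLre : 0 < L.re := by
    have h1 : L + (starRingEnd ℂ) L =
        M ((C (4 - A) * (1 - X) + C B * X : ℝ[X]).map (algebraMap ℝ ℂ) * (p * pb)) := by
      rw [hLdef, ← hM.conj, ← map_add, ← sub_eq_zero, ← map_sub, ← hM.parts (p * pb)]
      congr 1
      simp only [Polynomial.map_mul, Polynomial.map_sub, Polynomial.map_add, Polynomial.map_one,
        map_X, map_C, hpbp, ← hpb, ← derivative_map, Polynomial.map_ofNat, derivative_mul,
        Complex.coe_algebraMap, C_sub, map_ofNat]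
      ring
    rw [← h1, Complex.add_re, Complex.conj_re] at hL
    linarith
  have hKim : K = (K.re : ℂ) := ((Complex.conj_eq_iff_re).1 hKreal).symm
  have hLeq : L = (K.re : ℂ) / ζ + (c : ℂ) * (ρ / ζ) := by
    rw [← hKim]
    field_simp
    linear_combination -hKL
  rw [hLeq, Complex.add_re, Complex.re_ofReal_mul] at hLre
  have h1 : ((K.re : ℂ) / ζ).re ≤ 0 := by
    rw [div_eq_mul_inv, Complex.re_ofReal_mul, Complex.inv_re]
    exact mul_nonpos_of_nonneg_of_nonpos hK.le
      (div_nonpos_of_nonpos_of_nonneg hζ (Complex.normSq_nonneg _))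
  exact pos_of_mul_pos_right (by linarith : 0 < c * (ρ / ζ).re) hc.le

/-! ### Coefficients of Jacobi polynomials -/

/-- The coefficient of `((1 - x) / 2) ^ k` in the Jacobi polynomial `P_n^{(α,β)}`. -/
noncomputable def jacobiCoeff (n : ℕ) (α β : ℝ) (k : ℕ) : ℝ :=
  (ascPochhammer ℝ n).eval (α + 1) / (n.factorial : ℝ) *
    ((ascPochhammer ℝ k).eval (-(n : ℝ)) * (ascPochhammer ℝ k).eval ((n : ℝ) + α + β + 1) /
      ((k.factorial : ℝ) * (ascPochhammer ℝ k).eval (α + 1)))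

theorem ascPochhammer_eval_shift (k : ℕ) (a : ℝ) :
    a * (ascPochhammer ℝ k).eval (a + 1) = (ascPochhammer ℝ k).eval a * (a + k) := by
  rw [← ascPochhammer_succ_eval, ascPochhammer_succ_left]
  simp

section jacobiCoeff

variable {α β : ℝ}

theorem jacobiCoeff_succ (hα : -1 < α) (n k : ℕ) :
    (k + 1) * (k + α + 1) * jacobiCoeff n α β (k + 1) =
      (k - n) * (k + n + α + β + 1) * jacobiCoeff n α β k := by
  have h1 : (ascPochhammer ℝ k).eval (α + 1) ≠ 0 := (ascPochhammer_pos k _ (by linarith)).ne'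
  have h2 : α + 1 + k ≠ 0 := by
    have : (0 : ℝ) ≤ k := k.cast_nonneg
    linarith
  have h3 : (k.factorial : ℝ) ≠ 0 := by exact_mod_cast k.factorial_ne_zero
  have h4 : (n.factorial : ℝ) ≠ 0 := by exact_mod_cast n.factorial_ne_zero
  have h5 : (k : ℝ) + 1 ≠ 0 := by positivity
  unfold jacobiCoeff
  rw [ascPochhammer_succ_eval, ascPochhammer_succ_eval, ascPochhammer_succ_eval, Nat.factorial_succ]
  push_cast
  field_simp
  ring

theorem jacobiCoeff_eq_zero (hα : -1 < α) {n k : ℕ} (h : n < k) : jacobiCoeff n α β k = 0 := by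
  induction k, h using Nat.le_induction with
  | base =>
    have h1 := jacobiCoeff_succ (β := β) hα n n
    rw [sub_self, zero_mul, zero_mul] at h1
    have : (0 : ℝ) ≤ n := n.cast_nonneg
    exact (mul_eq_zero.1 h1).resolve_left (mul_pos (by linarith) (by linarith)).ne'
  | succ k _ ih =>
    have h1 := jacobiCoeff_succ (β := β) hα n k
    rw [ih, mul_zero] at h1
    have : (0 : ℝ) ≤ k := k.cast_nonneg
    exact (mul_eq_zero.1 h1).resolve_left (mul_pos (by linarith) (by linarith)).ne'

theorem jacobiCoeff_sign (hα : -1 < α) (hβ : -1 < β) {n k : ℕ} (hk : k ≤ n) :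
    0 < (-1) ^ k * jacobiCoeff n α β k := by
  induction k with
  | zero =>
    have : 0 < (ascPochhammer ℝ n).eval (α + 1) := ascPochhammer_pos n _ (by linarith)
    simp only [jacobiCoeff, ascPochhammer_zero, eval_one, pow_zero, Nat.factorial_zero, Nat.cast_one]
    positivity
  | succ k ih =>
    have ih := ih (by omega)
    have h1 := jacobiCoeff_succ (β := β) hα n k
    have h2 : (0 : ℝ) ≤ k := k.cast_nonneg
    have h3 : (k : ℝ) + 1 ≤ n := by exact_mod_cast hk
    have h4 : 0 < ((k : ℝ) + 1) * (k + α + 1) := mul_pos (by linarith) (by linarith)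
    have h5 : 0 < ((n : ℝ) - k) * (k + n + α + β + 1) := mul_pos (by linarith) (by linarith)
    refine pos_of_mul_pos_right (a := ((k : ℝ) + 1) * (k + α + 1)) ?_ h4.le
    have h6 := mul_pos h5 ih
    have e : ((k : ℝ) + 1) * (k + α + 1) * ((-1) ^ (k + 1) * jacobiCoeff n α β (k + 1)) =
      ((n : ℝ) - k) * (k + n + α + β + 1) * ((-1) ^ k * jacobiCoeff n α β k) := by
      rw [pow_succ]; linear_combination (-(-1) ^ k) * h1
    rwa [e]

theorem jacobiCoeff_even_pos (hα : -1 < α) (hβ : -1 < β) {n k : ℕ} (hk : 2 * k ≤ n) :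
    0 < jacobiCoeff n α β (2 * k) := by
  simpa [pow_mul] using jacobiCoeff_sign (β := β) hα hβ hk

/-- A contiguous relation in β; it reduces to two index shifts of Pochhammer symbols. It is what
ties φ_n^{(α,β-1)} to φ_n and φ_{n-1}. -/
theorem jacobiCoeff_sub_one (hα : -1 < α) (n k : ℕ) :
    (2 * (n + 1) + α + β) * jacobiCoeff (n + 1) α (β - 1) k =
      (n + 1 + α + β) * jacobiCoeff (n + 1) α β k + (n + 1 + α) * jacobiCoeff n α β k := by
  have h1 : (ascPochhammer ℝ k).eval (α + 1) ≠ 0 := (ascPochhammer_pos k _ (by linarith)).ne'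
  have h3 : (k.factorial : ℝ) ≠ 0 := by exact_mod_cast k.factorial_ne_zero
  have h4 : (n.factorial : ℝ) ≠ 0 := by exact_mod_cast n.factorial_ne_zero
  have h5 : (n : ℝ) + 1 ≠ 0 := by positivity
  have p1 := ascPochhammer_eval_shift k ((n : ℝ) + α + β + 1)
  have p2 := ascPochhammer_eval_shift k (-((n : ℝ) + 1))
  unfold jacobiCoeff
  rw [ascPochhammer_succ_eval, Nat.factorial_succ]
  push_cast
  rw [show (n : ℝ) + 1 + α + (β - 1) + 1 = n + α + β + 1 by ring,
    show (n : ℝ) + 1 + α + β + 1 = n + α + β + 1 + 1 by ring]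
  rw [show -((n : ℝ) + 1) + 1 = -(n : ℝ) by ring] at p2
  field_simp
  linear_combination (-(ascPochhammer ℝ n).eval (α + 1) * (α + 1 + n) *
    (ascPochhammer ℝ k).eval (-((n : ℝ) + 1))) * p1 +
    ((ascPochhammer ℝ n).eval (α + 1) * (α + 1 + n) *
    (ascPochhammer ℝ k).eval ((n : ℝ) + α + β + 1)) * p2

/-- The Jacobi polynomial in the variable `(1 - x) / 2`. -/
noncomputable def shiftedJacobi (n : ℕ) (α β : ℝ) : ℝ[X] :=
  ∑ k ∈ Finset.range (n + 1), C (jacobiCoeff n α β k) * X ^ k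

theorem coeff_shiftedJacobi (hα : -1 < α) (n k : ℕ) :
    (shiftedJacobi n α β).coeff k = jacobiCoeff n α β k := by
  rw [shiftedJacobi, finsetSum_coeff]
  simp only [coeff_C_mul_X_pow]
  rw [Finset.sum_ite_eq]
  split_ifs with h
  · rfl
  · rw [jacobiCoeff_eq_zero hα (by simpa using h)]

theorem jacobiP_eq_comp (n : ℕ) (α β : ℝ) :
    jacobiP n α β = (shiftedJacobi n α β).comp (C (1 / 2) * (1 - X)) := by
  rw [jacobiP, shiftedJacobi, Finset.mul_sum, sum_comp]
  refine Finset.sum_congr rfl fun k _ => ?_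
  rw [← mul_assoc, ← C_mul, ← jacobiCoeff]
  simp only [mul_comp, C_comp, pow_comp, X_comp]

theorem iterate_derivative_comp_half (p : ℝ[X]) (k : ℕ) :
    derivative^[k] (p.comp (C (1 / 2) * (1 - X))) =
      C ((-1 / 2) ^ k) * (derivative^[k] p).comp (C (1 / 2) * (1 - X)) := by
  induction k with
  | zero => simp
  | succ k ih =>
    rw [Function.iterate_succ_apply', ih, derivative_C_mul, derivative_comp,
      Function.iterate_succ_apply', pow_succ, C_mul, derivative_C_mul, derivative_sub,
      derivative_one, derivative_X, show (-1 / 2 : ℝ) = -(1 / 2) by norm_num, C_neg (a := 1 / 2)]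
    ring

theorem eval_one_iterate_derivative_jacobiP (hα : -1 < α) (n k : ℕ) :
    (derivative^[k] (jacobiP n α β)).eval 1 =
      (-1 / 2) ^ k * (k.factorial * jacobiCoeff n α β k) := by
  rw [jacobiP_eq_comp, iterate_derivative_comp_half, eval_mul, eval_C, eval_comp]
  simp only [eval_mul, eval_C, eval_sub, eval_one, eval_X, sub_self, mul_zero]
  rw [← coeff_zero_eq_eval_zero, coeff_iterate_derivative, zero_add, Nat.descFactorial_self,
    nsmul_eq_mul, coeff_shiftedJacobi hα]

theorem coeff_jacobiPhi (hα : -1 < α) (n k : ℕ) :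
    (jacobiPhi n α β).coeff k =
      (1 / 4) ^ k * ((2 * k).factorial * jacobiCoeff n α β (2 * k)) := by
  rw [jacobiPhi, finsetSum_coeff]
  simp only [coeff_C_mul_X_pow]
  rw [Finset.sum_ite_eq]
  split_ifs with h
  · rw [eval_one_iterate_derivative_jacobiP hα, pow_mul]; norm_num
  · rw [Finset.mem_range] at h
    rw [jacobiCoeff_eq_zero hα (by omega)]; ring

/-- The derivative of `∑ k, (P_n^{(α,β)})^{(k)}(1) z ^ k`. -/
noncomputable def jacobiHurwitz (n : ℕ) (α β : ℝ) : ℝ[X] :=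
  ∑ k ∈ Finset.range n,
    C ((k + 1) * ((k + 1).factorial * (-1 / 2) ^ (k + 1) * jacobiCoeff n α β (k + 1))) * X ^ k

theorem coeff_jacobiHurwitz (hα : -1 < α) (n k : ℕ) : (jacobiHurwitz n α β).coeff k =
    (k + 1) * ((k + 1).factorial * (-1 / 2) ^ (k + 1) * jacobiCoeff n α β (k + 1)) := by
  rw [jacobiHurwitz, finsetSum_coeff]
  simp only [coeff_C_mul_X_pow]
  rw [Finset.sum_ite_eq]
  split_ifs with h
  · rfl
  · rw [Finset.mem_range] at h
    rw [jacobiCoeff_eq_zero hα (by omega)]; ring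

theorem contract_divX_jacobiHurwitz (hα : -1 < α) (n : ℕ) :
    contract 2 (divX (jacobiHurwitz n α β)) = C 2 * derivative (jacobiPhi n α β) := by
  ext k
  rw [coeff_contract two_ne_zero, coeff_divX, coeff_jacobiHurwitz hα, coeff_C_mul, coeff_derivative,
    coeff_jacobiPhi hα, show k * 2 + 1 + 1 = 2 * (k + 1) by ring, pow_mul]
  push_cast
  norm_num
  ring

/-- Coefficientwise this is the recurrence `jacobiCoeff_succ`. Differentiation raises both Jacobi
parameters by one, hence α + 2 and β + 1. -/
theorem hypergeometricOp_derivative_shiftedJacobi (hα : -1 < α) (d : ℕ) :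
    hypergeometricOp (α + 2) (β + 1)
        ((derivative (shiftedJacobi (d + 1) α β)).map (algebraMap ℝ ℂ)) =
      -C ((d : ℂ) * (d + (α + 2 : ℝ) + (β + 1 : ℝ))) *
        (derivative (shiftedJacobi (d + 1) α β)).map (algebraMap ℝ ℂ) := by
  have hX : ∀ (q : ℂ[X]) (k : ℕ), (X * derivative q).coeff k = k * q.coeff k := by
    rintro q (_ | k)
    · simp
    · rw [coeff_X_mul, coeff_derivative]; push_cast; ring
  set v := (derivative (shiftedJacobi (d + 1) α β)).map (algebraMap ℝ ℂ) with hv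
  have hvk : ∀ k, v.coeff k = ((jacobiCoeff (d + 1) α β (k + 1) * (k + 1) : ℝ) : ℂ) := fun k => by
    rw [hv, coeff_map, coeff_derivative, coeff_shiftedJacobi hα]; rfl
  have e : hypergeometricOp (α + 2) (β + 1) v =
      X * derivative (derivative v) - X * derivative (X * derivative v) + X * derivative v +
        C ((α + 2 : ℝ) : ℂ) * derivative v -
          C ((α + 2 : ℝ) + (β + 1 : ℝ) + 1 : ℂ) * (X * derivative v) := by
    rw [hypergeometricOp, derivative_mul, derivative_X]; ring
  rw [e]
  ext k
  rw [← C_neg]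
  simp only [coeff_sub, coeff_add, coeff_C_mul, hX, coeff_derivative, hvk]
  have h := congrArg (fun x : ℝ => (x : ℂ)) (jacobiCoeff_succ (β := β) hα (d + 1) (k + 1))
  push_cast at h ⊢
  linear_combination ((k : ℂ) + 1) * h

end jacobiCoeff

/-! ### Stability of `jacobiHurwitz` -/

section jacobiHurwitz

variable {α β : ℝ}

theorem natDegree_jacobiHurwitz (hα : -1 < α) (hβ : -1 < β) (n : ℕ) :
    (jacobiHurwitz (n + 1) α β).natDegree = n := by
  refine natDegree_eq_of_le_of_coeff_ne_zero ?_ ?_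
  · rw [natDegree_le_iff_coeff_eq_zero]
    intro N hN
    rw [coeff_jacobiHurwitz hα, jacobiCoeff_eq_zero hα (by omega)]; ring
  · rw [coeff_jacobiHurwitz hα]
    have h1 := jacobiCoeff_sign (β := β) hα hβ (le_refl (n + 1))
    have h2 : jacobiCoeff (n + 1) α β (n + 1) ≠ 0 := fun h => by simp [h] at h1
    have h3 : ((n + 1).factorial : ℝ) ≠ 0 := by exact_mod_cast (n + 1).factorial_ne_zero
    have h4 : (n : ℝ) + 1 ≠ 0 := by positivity
    have h5 : (-1 / 2 : ℝ) ^ (n + 1) ≠ 0 := pow_ne_zero _ (by norm_num)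
    positivity

theorem eval_zero_jacobiHurwitz_pos (hα : -1 < α) (hβ : -1 < β) (n : ℕ) :
    0 < (jacobiHurwitz (n + 1) α β).eval 0 := by
  rw [← coeff_zero_eq_eval_zero, coeff_jacobiHurwitz hα]
  have h1 := jacobiCoeff_sign (β := β) hα hβ (show 1 ≤ n + 1 by omega)
  norm_num at h1 ⊢
  linarith

/-- By orthogonality the moment of u against X^m is the squared norm of u over its leading
coefficient; leading coefficients of consecutive degrees have opposite signs, hence the minus sign.
-/
theorem exists_leading_pairing (hα : -1 < α) (hβ : -1 < β) {M : ℂ[X] →ₗ[ℂ] ℂ}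
    (hM : IsBetaFunctional (α + 2) (β + 1) M) (m : ℕ) :
    ∃ c : ℝ, 0 < c ∧ (starRingEnd ℂ)
      (((derivative (shiftedJacobi (m + 2) α β)).map (algebraMap ℝ ℂ)).coeff (m + 1)) *
      M ((1 - X) * ((derivative (shiftedJacobi (m + 1) α β)).map (algebraMap ℝ ℂ) * X ^ m)) =
        -(c : ℂ) := by
  set u := (derivative (shiftedJacobi (m + 1) α β)).map (algebraMap ℝ ℂ) with hu
  have hAB : 0 < α + 2 + (β + 1) := by linarith
  have hl : u.coeff m = ((jacobiCoeff (m + 1) α β (m + 1) * (m + 1) : ℝ) : ℂ) := by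
    rw [hu, coeff_map, coeff_derivative, coeff_shiftedJacobi hα]; rfl
  have hr : ((derivative (shiftedJacobi (m + 2) α β)).map (algebraMap ℝ ℂ)).coeff (m + 1) =
      ((jacobiCoeff (m + 2) α β (m + 2) * (m + 2) : ℝ) : ℂ) := by
    rw [coeff_map, coeff_derivative, coeff_shiftedJacobi hα]
    push_cast; simp; left; ring
  have hud : u.natDegree ≤ m := by
    rw [natDegree_le_iff_coeff_eq_zero]
    intro N hN
    rw [hu, coeff_map, coeff_derivative, coeff_shiftedJacobi hα, jacobiCoeff_eq_zero hα (by omega)]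
    simp
  have hub : u.map (starRingEnd ℂ) = u := by
    ext k; rw [coeff_map, hu, coeff_map]; exact Complex.conj_ofReal _
  set a := jacobiCoeff (m + 1) α β (m + 1) * ((m : ℝ) + 1) with ha
  set b := jacobiCoeff (m + 2) α β (m + 2) * ((m : ℝ) + 2) with hb
  have hab : a * b < 0 := by
    have h1 := jacobiCoeff_sign (β := β) hα hβ (le_refl (m + 1))
    have h2 := jacobiCoeff_sign (β := β) hα hβ (le_refl (m + 2))
    have h3 := mul_pos h1 h2
    have h4 : (-1 : ℝ) ^ (m + 1) * jacobiCoeff (m + 1) α β (m + 1) *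
        ((-1) ^ (m + 2) * jacobiCoeff (m + 2) α β (m + 2)) =
        -(jacobiCoeff (m + 1) α β (m + 1) * jacobiCoeff (m + 2) α β (m + 2)) := by
      have : (-1 : ℝ) ^ (m * 2) = 1 := by rw [mul_comm, pow_mul]; norm_num
      ring_nf
      rw [this]; ring
    rw [h4] at h3
    have h5 : (0 : ℝ) < ((m : ℝ) + 1) * (m + 2) := by positivity
    rw [ha, hb]
    nlinarith
  have ha0 : a ≠ 0 := fun h => by simp [h] at hab
  have hu0 : u ≠ 0 := fun h => by
    rw [h, coeff_zero, eq_comm] at hl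
    exact ha0 (by exact_mod_cast hl)
  have hP := hM.pos (1 - X) (fun t ht => by simpa using ht.2) u hu0
  have hPe := hM.eigenfunction_apply hAB (hypergeometricOp_derivative_shiftedJacobi (β := β) hα m)
    hud
  rw [← hu, hl] at hPe
  rw [hub] at hP
  simp only [Polynomial.map_sub, Polynomial.map_one, map_X] at hP
  have hreal : (starRingEnd ℂ) (M ((1 - X) * (u * u))) = M ((1 - X) * (u * u)) := by
    rw [← hM.conj]
    simp only [Polynomial.map_sub, Polynomial.map_one, map_X, Polynomial.map_mul, hub]
  have hre := (Complex.conj_eq_iff_re).1 hreal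
  set P := (M ((1 - X) * (u * u))).re with hPdef
  rw [← hre] at hPe
  have ha0' : (a : ℂ) ≠ 0 := by exact_mod_cast ha0
  refine ⟨-(b / a) * P, mul_pos ?_ hP, ?_⟩
  · have : b / a = a * b / a ^ 2 := by field_simp
    rw [this, ← neg_div]
    exact div_pos (by linarith) (by positivity)
  · rw [hr, Complex.conj_ofReal]
    push_cast
    rw [hPe]
    field_simp

/-- The ratio `S_n / (z S_{n-1})` has positive real part on the closed right half-plane. -/
theorem re_div_neg_of_jacobiHurwitz_add_eq_zero (hα : -1 < α) (hα2 : α < 2) (hβ : -1 < β) (m : ℕ)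
    {ρ z : ℂ} (hz : 0 ≤ z.re) (hz0 : z ≠ 0)
    (h : ((jacobiHurwitz (m + 2) α β).map (algebraMap ℝ ℂ)).eval z +
      ρ * ((jacobiHurwitz (m + 1) α β).map (algebraMap ℝ ℂ)).eval z = 0) : (ρ / z).re < 0 := by
  obtain ⟨M, hM⟩ := exists_isBetaFunctional (A := α + 2) (B := β + 1) (by linarith) (by linarith)
  have hAB : 0 < α + 2 + (β + 1) := by linarith
  obtain ⟨c, hc, hκ⟩ := exists_leading_pairing hα hβ hM m
  set v := (derivative (shiftedJacobi (m + 2) α β)).map (algebraMap ℝ ℂ) with hv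
  set u := (derivative (shiftedJacobi (m + 1) α β)).map (algebraMap ℝ ℂ) with hu
  have hvk : ∀ k, v.coeff k = ((jacobiCoeff (m + 2) α β (k + 1) * (k + 1) : ℝ) : ℂ) := fun k => by
    rw [hv, coeff_map, coeff_derivative, coeff_shiftedJacobi hα]; rfl
  have huk : ∀ k, u.coeff k = ((jacobiCoeff (m + 1) α β (k + 1) * (k + 1) : ℝ) : ℂ) := fun k => by
    rw [hu, coeff_map, coeff_derivative, coeff_shiftedJacobi hα]; rfl
  have hopv := hypergeometricOp_derivative_shiftedJacobi (β := β) hα (m + 1)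
  have hopu := hypergeometricOp_derivative_shiftedJacobi (β := β) hα m
  -- The choice ζ = -z/2 absorbs the factor (-1/2)^k that comes from the variable (1 - x)/2.
  have key := hM.re_div_pos_of_zero (m := m) (u := u) (v := v) (ρ := ρ) (ζ := -z / 2) (c := c)
    (κ := M ((1 - X) * (u * X ^ m))) (by linarith) (by linarith)
    (fun T hT => by
      rw [hM.eigenfunction_apply hAB hopv (by omega : T.natDegree ≤ m + 1),
        coeff_eq_zero_of_natDegree_lt (by omega), zero_mul])
    (fun T hT => hM.eigenfunction_apply hAB hopu hT)
    (by
      rw [natDegree_le_iff_coeff_eq_zero]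
      intro N hN
      rw [coeff_add, coeff_C_mul, hvk, huk, jacobiCoeff_eq_zero hα (by omega),
        jacobiCoeff_eq_zero hα (by omega)]
      simp)
    hc
    (by
      rw [coeff_add, coeff_C_mul, huk, jacobiCoeff_eq_zero hα (by omega)]
      simpa using hκ)
    (by
      rw [Complex.div_re]
      norm_num
      linarith)
    (by simpa using hz0)
    (by
      rw [eval_eq_sum_range' (n := m + 2) (by
          rw [natDegree_map, natDegree_jacobiHurwitz hα hβ]; omega),
        eval_eq_sum_range' (n := m + 2) (by
          rw [natDegree_map, natDegree_jacobiHurwitz hα hβ]; omega), Finset.mul_sum,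
        ← Finset.sum_add_distrib] at h
      rw [Finset.sum_range_succ', mul_coeff_zero, coeff_X_zero, zero_mul, mul_zero, zero_mul,
        add_zero]
      rw [← mul_zero z, ← h, Finset.mul_sum]
      refine Finset.sum_congr rfl fun k _ => ?_
      rw [coeff_X_mul, coeff_add, coeff_C_mul, hvk, huk, coeff_map, coeff_map,
        coeff_jacobiHurwitz hα, coeff_jacobiHurwitz hα]
      simp only [Complex.coe_algebraMap]
      push_cast
      rw [show -z / 2 = (-1 / 2) * z by ring, mul_pow]
      ring)
  have e : ρ / (-z / 2) = ((-2 : ℝ) : ℂ) * (ρ / z) := by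
    push_cast
    field_simp
  rw [e, Complex.re_ofReal_mul] at key
  linarith

theorem isHurwitz_jacobiHurwitz_add (hα : -1 < α) (hα2 : α < 2) (hβ : -1 < β) (m : ℕ)
    {ρ : ℝ} (hρ : 0 ≤ ρ) :
    IsHurwitz (jacobiHurwitz (m + 2) α β + C ρ * jacobiHurwitz (m + 1) α β) := by
  intro z hz
  by_contra! hre
  have hz0 : z ≠ 0 := by
    rintro rfl
    rw [← Complex.ofReal_zero, eval_map_algebraMap_ofReal] at hz
    have h1 := eval_zero_jacobiHurwitz_pos hα hβ (m + 1)
    have h2 := eval_zero_jacobiHurwitz_pos hα hβ m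
    have h3 : eval 0 (jacobiHurwitz (m + 2) α β + C ρ * jacobiHurwitz (m + 1) α β) = 0 := by
      exact_mod_cast hz
    rw [eval_add, eval_mul, eval_C] at h3
    have := mul_nonneg hρ h2.le
    linarith
  rw [Polynomial.map_add, Polynomial.map_mul, map_C, eval_add, eval_mul, eval_C] at hz
  have h := re_div_neg_of_jacobiHurwitz_add_eq_zero hα hα2 hβ m hre hz0 hz
  rw [Complex.coe_algebraMap, div_eq_mul_inv, Complex.re_ofReal_mul, Complex.inv_re] at h
  have := mul_nonneg hρ (div_nonneg hre (Complex.normSq_nonneg z))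
  linarith

theorem isHurwitz_jacobiHurwitz (hα : -1 < α) (hα2 : α < 2) (hβ : -1 < β) (m : ℕ) :
    IsHurwitz (jacobiHurwitz (m + 2) α β) := by
  simpa using isHurwitz_jacobiHurwitz_add hα hα2 hβ m le_rfl

end jacobiHurwitz

/-! ### Zeros and Wronskians of the derivatives of `jacobiPhi` -/

section jacobiPhi

variable {α β : ℝ}

theorem jacobiHurwitz_eq_even_add_odd (hα : -1 < α) (n : ℕ) : jacobiHurwitz n α β =
    expand ℝ 2 (contract 2 (jacobiHurwitz n α β)) +
      X * expand ℝ 2 (C 2 * derivative (jacobiPhi n α β)) := by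
  rw [← contract_divX_jacobiHurwitz hα]
  exact expand_contract_add_X_mul_expand_contract _

theorem coeff_derivative_jacobiPhi_nonneg (hα : -1 < α) (hβ : -1 < β) (n k : ℕ) :
    0 ≤ (derivative (jacobiPhi n α β)).coeff k := by
  rw [coeff_derivative, coeff_jacobiPhi hα]
  rcases le_or_gt (2 * (k + 1)) n with h | h
  · have := jacobiCoeff_even_pos hα hβ h
    positivity
  · rw [jacobiCoeff_eq_zero hα h]; simp

theorem coeff_derivative_jacobiPhi_pos (hα : -1 < α) (hβ : -1 < β) {n k : ℕ}
    (h : 2 * (k + 1) ≤ n) : 0 < (derivative (jacobiPhi n α β)).coeff k := by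
  rw [coeff_derivative, coeff_jacobiPhi hα]
  have := jacobiCoeff_even_pos hα hβ h
  positivity

theorem natDegree_derivative_jacobiPhi (hα : -1 < α) (hβ : -1 < β) (n : ℕ) :
    (derivative (jacobiPhi (n + 2) α β)).natDegree = n / 2 := by
  refine natDegree_eq_of_le_of_coeff_ne_zero ?_
    (coeff_derivative_jacobiPhi_pos hα hβ (by omega)).ne'
  rw [natDegree_le_iff_coeff_eq_zero]
  intro N hN
  rw [coeff_derivative, coeff_jacobiPhi hα, jacobiCoeff_eq_zero hα (by omega)]
  ring

theorem derivative_jacobiPhi_zero (hα : -1 < α) (hα2 : α < 2) (hβ : -1 < β) (m : ℕ) {ρ : ℝ}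
    (hρ : 0 ≤ ρ) {μ : ℂ} (hμ : ((derivative (jacobiPhi (m + 3) α β) +
      C ρ * derivative (jacobiPhi (m + 2) α β)).map (algebraMap ℝ ℂ)).eval μ = 0) : μ.im = 0 := by
  have hH := isHurwitz_jacobiHurwitz_add hα hα2 hβ (m + 1) hρ
  have hdeg : (jacobiHurwitz (m + 1 + 2) α β + C ρ * jacobiHurwitz (m + 1 + 1) α β).natDegree ≠ 0 := by
    rw [natDegree_add_eq_left_of_natDegree_lt]
    · rw [natDegree_jacobiHurwitz hα hβ]; omega
    · refine (natDegree_C_mul_le _ _).trans_lt ?_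
      rw [natDegree_jacobiHurwitz hα hβ, natDegree_jacobiHurwitz hα hβ]; omega
  obtain ⟨s, -, rfl⟩ := hH.oddPart_zero
    (e := contract 2 (jacobiHurwitz (m + 3) α β) + C ρ * contract 2 (jacobiHurwitz (m + 2) α β))
    (o := C 2 * (derivative (jacobiPhi (m + 3) α β) + C ρ * derivative (jacobiPhi (m + 2) α β)))
    (by
      conv_lhs => rw [jacobiHurwitz_eq_even_add_odd hα (m + 1 + 2),
        jacobiHurwitz_eq_even_add_odd hα (m + 1 + 1)]
      simp only [map_add, map_mul, expand_C]
      ring) hdeg (μ := μ) (by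
      rw [Polynomial.map_mul, eval_mul, hμ, mul_zero])
  exact Complex.ofReal_im _

theorem derivative_jacobiPhi_zero_neg (hα : -1 < α) (hα2 : α < 2) (hβ : -1 < β) (m : ℕ) {μ : ℂ}
    (hμ : ((derivative (jacobiPhi (m + 2) α β)).map (algebraMap ℝ ℂ)).eval μ = 0) :
    ∃ s : ℝ, 0 < s ∧ μ = ((-s ^ 2 : ℝ) : ℂ) :=
  (isHurwitz_jacobiHurwitz hα hα2 hβ m).oddPart_zero (jacobiHurwitz_eq_even_add_odd hα _)
    (by rw [natDegree_jacobiHurwitz hα hβ]; omega)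
    (by rw [Polynomial.map_mul, eval_mul, hμ, mul_zero])

/-- Both signs are compared with the even part of S_{m+2} at x = -s²: it has the sign of φ_{m+3}'(x)
by the half-plane estimate, and the sign opposite to φ_{m+2}''(x) by stability. -/
theorem derivative_jacobiPhi_root_sign (hα : -1 < α) (hα2 : α < 2) (hβ : -1 < β) (m : ℕ) {x : ℝ}
    (hx : (derivative (jacobiPhi (m + 2) α β)).eval x = 0) :
    (derivative (jacobiPhi (m + 3) α β)).eval x *
      (derivative (derivative (jacobiPhi (m + 2) α β))).eval x < 0 := by
  obtain ⟨s, hs, hxs⟩ := derivative_jacobiPhi_zero_neg hα hα2 hβ m (μ := x)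
    (by rw [eval_map_algebraMap_ofReal, hx, Complex.ofReal_zero])
  obtain rfl : x = -s ^ 2 := by exact_mod_cast hxs
  have h1 := (isHurwitz_jacobiHurwitz hα hα2 hβ m).oddPart_derivative_mul_evenPart_neg
    (jacobiHurwitz_eq_even_add_odd hα _) (by rw [natDegree_jacobiHurwitz hα hβ]; omega) (s := s)
    (by rw [eval_mul, hx, mul_zero])
  rw [derivative_C_mul, eval_mul, eval_C] at h1
  set eh := (contract 2 (jacobiHurwitz (m + 2) α β)).eval (-s ^ 2) with heh
  set eg := (contract 2 (jacobiHurwitz (m + 3) α β)).eval (-s ^ 2) with heg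
  set g := (derivative (jacobiPhi (m + 3) α β)).eval (-s ^ 2) with hg
  set h' := (derivative (derivative (jacobiPhi (m + 2) α β))).eval (-s ^ 2)
  have heh0 : eh ≠ 0 := fun h => by simp [h] at h1
  have hsq : ((s : ℂ) * Complex.I) ^ 2 = ((-s ^ 2 : ℝ) : ℂ) := by
    rw [mul_pow, Complex.I_sq]; push_cast; ring
  have vh : ((jacobiHurwitz (m + 2) α β).map (algebraMap ℝ ℂ)).eval (s * Complex.I) = (eh : ℂ) := by
    rw [eval_map_eq_even_add_odd (jacobiHurwitz_eq_even_add_odd hα _), hsq,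
      eval_map_algebraMap_ofReal, eval_map_algebraMap_ofReal, eval_mul, hx]
    simp [heh]
  have vg : ((jacobiHurwitz (m + 3) α β).map (algebraMap ℝ ℂ)).eval (s * Complex.I) =
      (eg : ℂ) + s * Complex.I * (2 * g) := by
    rw [eval_map_eq_even_add_odd (jacobiHurwitz_eq_even_add_odd hα _), hsq,
      eval_map_algebraMap_ofReal, eval_map_algebraMap_ofReal, eval_mul, eval_C, ← hg, ← heg]
    push_cast; ring
  have heh0' : (eh : ℂ) ≠ 0 := by exact_mod_cast heh0
  have hs0' : (s : ℂ) ≠ 0 := by exact_mod_cast hs.ne'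
  -- Here ρ = -S_{m+3}/S_{m+2} at z = is, so the estimate bounds the ratio itself.
  have h2 := re_div_neg_of_jacobiHurwitz_add_eq_zero hα hα2 hβ (m + 1)
    (ρ := -((eg : ℂ) + s * Complex.I * (2 * g)) / eh) (z := s * Complex.I) (by simp)
    (mul_ne_zero hs0' Complex.I_ne_zero) (by
      rw [show m + 1 + 2 = m + 3 by ring, show m + 1 + 1 = m + 2 by ring, vg, vh]
      field_simp
      ring)
  have e : -((eg : ℂ) + s * Complex.I * (2 * g)) / eh / (s * Complex.I) =
      ((-2 * (g / eh) : ℝ) : ℂ) + ((eg / (eh * s) : ℝ) : ℂ) * Complex.I := by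
    push_cast
    field_simp
    linear_combination (-(eg : ℂ)) * Complex.I_sq
  rw [e] at h2
  simp only [Complex.add_re, Complex.ofReal_re, Complex.mul_re, Complex.I_re, Complex.I_im,
    Complex.ofReal_im, mul_zero, zero_mul, sub_zero, add_zero] at h2
  have heh2 : 0 < eh ^ 2 := by positivity
  have h3 : 0 < g * eh := by
    have h4 : g * eh = g / eh * eh ^ 2 := by field_simp
    rw [h4]
    exact mul_pos (by linarith) heh2
  have h4 : g * h' * eh ^ 2 < 0 := by nlinarith
  by_contra! h5
  nlinarith

theorem wronskian_derivative_jacobiPhi_pos (hα : -1 < α) (hα2 : α < 2) (hβ : -1 < β) (m : ℕ)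
    (x : ℝ) :
    0 < (derivative (derivative (jacobiPhi (m + 4) α β))).eval x *
        (derivative (jacobiPhi (m + 3) α β)).eval x -
      (derivative (jacobiPhi (m + 4) α β)).eval x *
        (derivative (derivative (jacobiPhi (m + 3) α β))).eval x := by
  have hd : (derivative (jacobiPhi (m + 3) α β)).natDegree = (m + 1) / 2 :=
    natDegree_derivative_jacobiPhi hα hβ (m + 1)
  have hlc : 0 < (derivative (jacobiPhi (m + 3) α β)).leadingCoeff := by
    rw [leadingCoeff, hd]
    exact coeff_derivative_jacobiPhi_pos hα hβ (by omega)
  refine wronskian_pos_of_root_sign (leadingCoeff_ne_zero.1 hlc.ne') (fun z hz => ?_)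
    (fun y hy => derivative_jacobiPhi_root_sign hα hα2 hβ (m + 1) hy) ?_ ?_ ?_ x
  · obtain ⟨s, -, rfl⟩ := derivative_jacobiPhi_zero_neg hα hα2 hβ (m + 1) hz
    exact Complex.ofReal_im _
  · rw [hd, natDegree_derivative_jacobiPhi hα hβ (m + 2)]; omega
  · exact mul_nonneg (coeff_derivative_jacobiPhi_nonneg hα hβ _ _) hlc.le
  · rw [hd]
    intro h0
    exact mul_pos (coeff_derivative_jacobiPhi_pos hα hβ (by omega)) hlc

theorem jacobiPhi_sub_one (hα : -1 < α) (n : ℕ) :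
    C (2 * (n + 1) + α + β) * jacobiPhi (n + 1) α (β - 1) =
      C (n + 1 + α + β) * jacobiPhi (n + 1) α β + C (n + 1 + α) * jacobiPhi n α β := by
  ext k
  rw [coeff_add, coeff_C_mul, coeff_C_mul, coeff_C_mul, coeff_jacobiPhi hα, coeff_jacobiPhi hα,
    coeff_jacobiPhi hα]
  linear_combination ((1 / 4) ^ k * ((2 * k).factorial : ℝ)) *
    jacobiCoeff_sub_one (β := β) hα n (2 * k)

/-- The condition n ≥ 1 makes n + 1 + α + β positive for all α, β > -1. -/
theorem exists_jacobiPhi_sub_one_eq (hα : -1 < α) (hβ : -1 < β) {n : ℕ} (hn : 1 ≤ n) :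
    ∃ a b : ℝ, 0 < a ∧ 0 < b ∧
      jacobiPhi (n + 1) α (β - 1) = C a * jacobiPhi (n + 1) α β + C b * jacobiPhi n α β := by
  have hn' : (1 : ℝ) ≤ n := by exact_mod_cast hn
  have h1 : 0 < 2 * ((n : ℝ) + 1) + α + β := by linarith
  refine ⟨(n + 1 + α + β) / (2 * (n + 1) + α + β), (n + 1 + α) / (2 * (n + 1) + α + β),
    div_pos (by linarith) h1, div_pos (by linarith) h1, ?_⟩
  refine mul_left_cancel₀ (C_ne_zero.2 h1.ne') ?_
  rw [jacobiPhi_sub_one hα, mul_add, ← mul_assoc, ← mul_assoc, ← C_mul, ← C_mul,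
    mul_div_cancel₀ _ h1.ne', mul_div_cancel₀ _ h1.ne']

end jacobiPhi

/-! ### The three interlacing pairs -/

theorem lemma1 (n : ℕ) (hn : 3 ≤ n) (α β : ℝ)
    (h : (-1 < α ∧ α < 1 ∧ -1 < β) ∨ (1 ≤ α ∧ α < 2 ∧ 0 < β)) :
    ZerosInterlace (derivative (jacobiPhi n α β)) (derivative (jacobiPhi (n - 1) α β)) ∧
    ZerosInterlace (derivative (jacobiPhi n α β)) (derivative (jacobiPhi n α (β - 1))) ∧
    ZerosInterlace (derivative (jacobiPhi (n - 1) α β)) (derivative (jacobiPhi n α (β - 1))) := by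
  obtain ⟨hα, hα2, hβ⟩ : -1 < α ∧ α < 2 ∧ -1 < β := by
    rcases h with ⟨h1, h2, h3⟩ | ⟨h1, h2, h3⟩ <;> exact ⟨by linarith, by linarith, by linarith⟩
  obtain ⟨m, rfl⟩ : ∃ m, n = m + 3 := ⟨n - 3, by omega⟩
  rw [show m + 3 - 1 = m + 2 by omega]
  obtain ⟨a, b, ha, hb, hab⟩ :=
    exists_jacobiPhi_sub_one_eq (β := β) hα hβ (show 1 ≤ m + 2 by omega)
  rw [show m + 2 + 1 = m + 3 by ring] at hab
  have hfe : derivative (jacobiPhi (m + 3) α (β - 1)) =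
      C a * derivative (jacobiPhi (m + 3) α β) + C b * derivative (jacobiPhi (m + 2) α β) := by
    rw [hab, derivative_add, derivative_C_mul, derivative_C_mul]
  rw [hfe]
  have hg : ∀ z : ℂ, ((derivative (jacobiPhi (m + 3) α β)).map (algebraMap ℝ ℂ)).eval z = 0 →
      z.im = 0 := fun z hz => derivative_jacobiPhi_zero hα hα2 hβ m le_rfl (by simpa using hz)
  have hh : ∀ z : ℂ, ((derivative (jacobiPhi (m + 2) α β)).map (algebraMap ℝ ℂ)).eval z = 0 →
      z.im = 0 := fun z hz => by
    obtain ⟨s, -, rfl⟩ := derivative_jacobiPhi_zero_neg hα hα2 hβ m hz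
    exact Complex.ofReal_im _
  have hf : ∀ z : ℂ, ((C a * derivative (jacobiPhi (m + 3) α β) +
      C b * derivative (jacobiPhi (m + 2) α β)).map (algebraMap ℝ ℂ)).eval z = 0 → z.im = 0 := by
    intro z hz
    refine derivative_jacobiPhi_zero hα hα2 hβ m (div_nonneg hb.le ha.le) (ρ := b / a) ?_
    have e : C a * derivative (jacobiPhi (m + 3) α β) + C b * derivative (jacobiPhi (m + 2) α β) =
        C a * (derivative (jacobiPhi (m + 3) α β) +
          C (b / a) * derivative (jacobiPhi (m + 2) α β)) := by
      rw [mul_add, ← mul_assoc (C a) (C (b / a)), ← C_mul, mul_div_cancel₀ _ ha.ne']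
    rw [e, Polynomial.map_mul, eval_mul, map_C, eval_C] at hz
    exact (mul_eq_zero.1 hz).resolve_left (by simpa using ha.ne')
  -- For n = 3 all three derivatives are nonzero constants; for n ≥ 4 the Wronskian is positive.
  rcases m with _ | m
  · have hc3 := coeff_derivative_jacobiPhi_pos hα hβ (show 2 * (0 + 1) ≤ 3 by norm_num)
    have hc2 := coeff_derivative_jacobiPhi_pos hα hβ (show 2 * (0 + 1) ≤ 2 by norm_num)
    have h3 := eq_C_of_natDegree_eq_zero
      (show (derivative (jacobiPhi (0 + 3) α β)).natDegree = 0 from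
        natDegree_derivative_jacobiPhi hα hβ 1)
    have h2 := eq_C_of_natDegree_eq_zero
      (show (derivative (jacobiPhi (0 + 2) α β)).natDegree = 0 from
        natDegree_derivative_jacobiPhi hα hβ 0)
    rw [h3, h2, ← C_mul, ← C_mul, ← C_add]
    have hpos := add_pos (mul_pos ha hc3) (mul_pos hb hc2)
    exact ⟨zerosInterlace_C hc3.ne' hc2.ne', zerosInterlace_C hc3.ne' hpos.ne',
      zerosInterlace_C hc2.ne' hpos.ne'⟩
  · have hW := wronskian_derivative_jacobiPhi_pos hα hα2 hβ m
    refine ⟨zerosInterlace_of_wronskian_ne_zero hg hh fun x => (hW x).ne',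
      zerosInterlace_of_wronskian_ne_zero hg hf fun x => ?_,
      zerosInterlace_of_wronskian_ne_zero hh hf fun x => ?_⟩
    -- With g = φ_n' and h = φ_{n-1}', the Wronskian of g and ag + bh is b times that of g and h;
    -- for h and ag + bh it is -a times.
    · have := mul_pos hb (hW x)
      simp only [derivative_add, derivative_C_mul, eval_add, eval_mul, eval_C]
      refine ne_of_gt (this.trans_eq ?_)
      ring
    · have := mul_pos ha (hW x)
      simp only [derivative_add, derivative_C_mul, eval_add, eval_mul, eval_C]
      refine ne_of_lt (lt_of_eq_of_lt (b := -(a * _)) ?_ (neg_lt_zero.2 this))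
      ring
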